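/- Let $k$ be a field and let $Q_A$, $Q_B$, $Q_C$ be finite quivers such that the vertex set of $Q_C$ is the disjoint union of those of $Q_A$ and $Q_B$, and the arrows of $Q_C$ are those of $Q_A$, those of $Q_B$, finitely many arrows $\alpha_j$ ($j\in J$) from vertices of $Q_A$ to vertices of $Q_B$, and finitely many arrows $\beta_l$ ($l\in K$) from vertices of $Q_B$ to vertices of $Q_A$. Paths are composed from left to right. Let $I_A, I_B, I_C$ be admissible ideals of the path algebras $kQ_A, kQ_B, kQ_C$, and let $A=kQ_A/I_A$, $B=kQ_B/I_B$, $C=kQ_C/I_C$ be the corresponding finite dimensional algebras. Assume that $I_C\cap kQ_A=I_A$ and $I_C\cap kQ_B=I_B$ (so that $A$ and $B$ are the diagonal corners of $C$), and that $I_C$ contains all products $\alpha\alpha_j$, $\beta\beta_l$, $\alpha_j\beta_l$, $\beta_l\alpha_j$ with $\alpha$ an arrow of $Q_A$, $\beta$ an arrow of $Q_B$, $j\in J$, $l\in K$. Modules are finitely generated right modules. An $A$-module or $B$-module is viewed as a $C$-module by extending the corresponding representation by zero, and $\Pi_A$, $\Pi_B$ denote the restriction of representations of $Q_C$ to $Q_A$,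 $Q_B$. For a module $M$ let $\Omega(M)$ be the kernel of its projective cover and $\mathrm{Orb}_\Omega(M)=\{\Omega^n(M)\}_{n\ge 0}$; let $\mathrm{add}\,\mathcal X$ be the class of finite direct sums of direct summands of members of $\mathcal X$; let $A_0$, $B_0$ be the direct sums of the simple $A$-modules, resp. $B$-modules, one from each isomorphism class. Let $K_0(C)$ be the abelian group generated by the symbols $[M]$, $M$ a $C$-module, modulo $[M]=[M']+[M'']$ whenever $M\cong M'\oplus M''$ and $[P]=0$ for $P$ projective, and let $\bar\Omega$ be the endomorphism of $K_0(C)$ with $\bar\Omega[M]=[\Omega_C(M)]$. Let $$\mathcal O=[\mathrm{add}\,\mathrm{Orb}_{\Omega_A}(\Pi_A(\Omega_C(B_0)))\times \mathrm{add}\,\mathrm{Orb}_{\Omega_B}(\Pi_B(\Omega_C(A_0)))]\subset K_0(C)$$ be the subgroup generated by the classes of the modules of these two subcategories. Assume that $\mathcal O$ is syzygy finite, that is, $\bar\Omega^n(\mathcal O)$ is finitely generated for some $n\ge 0$. For a class $\mathcal X$ of modules let $\mathrm{findim}\,\mathcal X$ be the supremum of the projective dimensions of the members of $\mathcal X$ that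 have finite projective dimension, and let $\mathrm{findim}(A)$ be that of the class of all $A$-modules; likewise for $B$ and $C$. If $\mathrm{findim}(A)<\infty$ and $\mathrm{findim}(B)<\infty$, then $\mathrm{findim}(C)<\infty$. Moreover, $$\mathrm{pd}(M)\le \max(\mathrm{findim}(A),\mathrm{findim}(B))+2+\mathrm{findim}\{N : [N]\in\mathcal O\}$$ for every $C$-module $M$ of finite projective dimension. -/

import Mathlib

open CategoryTheory

universe u

noncomputable section

/-! ## Path algebras of finite quivers -/

/-- The paths of a quiver, with arbitrary start and target (trivial paths included). -/
abbrev AllPaths (V : Type u) [Quiver.{u} V] : Type u := Σ a : V, Σ b : V, Quiver.Path a b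

namespace AllPaths

variable {V : Type u} [Quiver.{u} V]

/-- The length of a path. -/
def length (p : AllPaths V) : ℕ := p.2.2.length

/-- The trivial path at a vertex. -/
def triv (v : V) : AllPaths V := ⟨v, v, Quiver.Path.nil⟩

/-- An arrow as a path of length one. -/
def ofArrow {a b : V} (f : a ⟶ b) : AllPaths V := ⟨a, b, f.toPath⟩

/-- The concatenation `pq` (first `p`, then `q`) of two composable paths. -/
def comp (p q : AllPaths V) (h : p.2.1 = q.1) : AllPaths V :=
  ⟨p.1, q.2.1, p.2.2.comp (q.2.2.cast h.symm rfl)⟩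

theorem comp_assoc (p q r : AllPaths V) (h : p.2.1 = q.1) (h' : q.2.1 = r.1) :
    (p.comp q h).comp r h' = p.comp (q.comp r h') h := by
  obtain ⟨a, b, p⟩ := p
  obtain ⟨b', c, q⟩ := q
  obtain ⟨c', d, r⟩ := r
  dsimp at h h'
  subst h h'
  simp [comp, Quiver.Path.comp_assoc]

theorem triv_comp (p : AllPaths V) : (triv p.1).comp p rfl = p := by
  simp [comp, triv]

theorem comp_triv (p : AllPaths V) : p.comp (triv p.2.1) rfl = p := by
  simp [comp, triv]

end AllPaths

/-- The path algebra `kQ` of a quiver: the `k`-vector space with basis the set of all paths. -/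
def PathAlgebra (k : Type u) [Field k] (V : Type u) [Quiver.{u} V] : Type u := AllPaths V →₀ k

namespace PathAlgebra

variable {k : Type u} [Field k] {V : Type u} [Quiver.{u} V]

instance : AddCommGroup (PathAlgebra k V) := inferInstanceAs (AddCommGroup (AllPaths V →₀ k))

instance : Module k (PathAlgebra k V) := inferInstanceAs (Module k (AllPaths V →₀ k))

variable (k) in
/-- The basis element of the path algebra that belongs to a path. -/
def ofPath (p : AllPaths V) : PathAlgebra k V := Finsupp.single p (1 : k)

variable (k) in
/-- The element of the path algebra that belongs to an arrow. -/
def arrow {a b : V} (f : a ⟶ b) : PathAlgebra k V := ofPath k (AllPaths.ofArrow f)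

/-- The coefficient of a path. -/
def coeff (x : PathAlgebra k V) (p : AllPaths V) : k := (show AllPaths V →₀ k from x) p

/-- Linear maps out of the path algebra are given by their values on paths. -/
def lift {M : Type u} [AddCommGroup M] [Module k M] (g : AllPaths V → M) :
    PathAlgebra k V →ₗ[k] M :=
  Finsupp.linearCombination k g

theorem lift_ofPath {M : Type u} [AddCommGroup M] [Module k M] (g : AllPaths V → M)
    (p : AllPaths V) : lift g (ofPath k p) = g p :=
  (Finsupp.linearCombination_single k (1 : k) p).trans (one_smul k (g p))

theorem hom_ext {M : Type*} [AddCommGroup M] [Module k M] {f g : PathAlgebra k V →ₗ[k] M}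
    (h : ∀ p, f (ofPath k p) = g (ofPath k p)) : f = g :=
  Finsupp.lhom_ext' fun p => LinearMap.ext_ring (h p)

open Classical in
variable (k) in
/-- The product of two paths: concatenation if they are composable, and zero otherwise. -/
def mulPath (p q : AllPaths V) : PathAlgebra k V :=
  if h : p.2.1 = q.1 then ofPath k (p.comp q h) else 0

variable (k V) in
/-- The multiplication as a bilinear map. -/
def mulHom : PathAlgebra k V →ₗ[k] PathAlgebra k V →ₗ[k] PathAlgebra k V :=
  lift fun p => lift fun q => mulPath k p q

instance : Mul (PathAlgebra k V) := ⟨fun x y => mulHom k V x y⟩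

theorem mul_def (x y : PathAlgebra k V) : x * y = mulHom k V x y := rfl

theorem ofPath_mul_ofPath (p q : AllPaths V) :
    ofPath k p * ofPath k q = mulPath k p q := by
  rw [mul_def, mulHom, lift_ofPath, lift_ofPath]

theorem mulHom_mulPath_left (p q r : AllPaths V) :
    mulHom k V (mulPath k p q) (ofPath k r) = mulHom k V (ofPath k p) (mulPath k q r) := by
  by_cases h : p.2.1 = q.1 <;> by_cases h' : q.2.1 = r.1
  · have e1 : mulPath k p q = ofPath k (p.comp q h) := dif_pos h
    have e2 : mulPath k q r = ofPath k (q.comp r h') := dif_pos h'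
    rw [e1, e2, ← mul_def, ← mul_def, ofPath_mul_ofPath, ofPath_mul_ofPath]
    have e3 : mulPath k (p.comp q h) r = ofPath k ((p.comp q h).comp r h') := dif_pos h'
    have e4 : mulPath k p (q.comp r h') = ofPath k (p.comp (q.comp r h') h) := dif_pos h
    rw [e3, e4, AllPaths.comp_assoc]
  · have e1 : mulPath k p q = ofPath k (p.comp q h) := dif_pos h
    have e2 : mulPath k q r = 0 := dif_neg h'
    rw [e1, e2, ← mul_def, ofPath_mul_ofPath, map_zero]
    exact dif_neg h'
  · have e1 : mulPath k p q = 0 := dif_neg h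
    have e2 : mulPath k q r = ofPath k (q.comp r h') := dif_pos h'
    have e3 : mulPath k p (q.comp r h') = 0 := dif_neg h
    rw [e1, e2, ← mul_def (ofPath k p), ofPath_mul_ofPath, map_zero, LinearMap.zero_apply, e3]
  · have e1 : mulPath k p q = 0 := dif_neg h
    have e2 : mulPath k q r = 0 := dif_neg h'
    rw [e1, e2, map_zero, map_zero, LinearMap.zero_apply]

theorem mul_assoc' (x y z : PathAlgebra k V) : x * y * z = x * (y * z) := by
  have key : (LinearMap.llcomp k _ _ _ (mulHom k V)).comp (mulHom k V) =
      ((LinearMap.llcomp k _ _ _).flip (mulHom k V)).comp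
        ((LinearMap.llcomp k _ _ (PathAlgebra k V)).comp (mulHom k V)) := by
    refine hom_ext fun p => hom_ext fun q => hom_ext fun r => ?_
    simp only [LinearMap.comp_apply, LinearMap.llcomp_apply, LinearMap.flip_apply, ← mul_def,
      ofPath_mul_ofPath]
    simpa only [mul_def] using mulHom_mulPath_left p q r
  have := LinearMap.congr_fun (LinearMap.congr_fun (LinearMap.congr_fun key x) y) z
  simpa only [LinearMap.comp_apply, LinearMap.llcomp_apply, LinearMap.flip_apply, ← mul_def]
    using this

variable [Fintype V]

/-- The unit is the sum of all trivial paths. -/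
instance : One (PathAlgebra k V) := ⟨∑ v : V, ofPath k (AllPaths.triv v)⟩

theorem one_def : (1 : PathAlgebra k V) = ∑ v : V, ofPath k (AllPaths.triv v) := rfl

theorem one_mul' (x : PathAlgebra k V) : 1 * x = x := by
  have key : mulHom k V 1 = LinearMap.id := by
    refine hom_ext fun p => ?_
    rw [one_def, map_sum, LinearMap.sum_apply, Finset.sum_eq_single p.1]
    · rw [← mul_def, ofPath_mul_ofPath]
      exact (dif_pos rfl).trans (congrArg (ofPath k) (AllPaths.triv_comp p))
    · intro v _ hv
      rw [← mul_def, ofPath_mul_ofPath]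
      exact dif_neg hv
    · intro h
      exact absurd (Finset.mem_univ _) h
  exact LinearMap.congr_fun key x

theorem mul_one' (x : PathAlgebra k V) : x * 1 = x := by
  have key : (mulHom k V).flip 1 = LinearMap.id := by
    refine hom_ext fun p => ?_
    rw [one_def, map_sum, LinearMap.sum_apply, Finset.sum_eq_single p.2.1]
    · rw [LinearMap.flip_apply, ← mul_def, ofPath_mul_ofPath]
      exact (dif_pos rfl).trans (congrArg (ofPath k) (AllPaths.comp_triv p))
    · intro v _ hv
      rw [LinearMap.flip_apply, ← mul_def, ofPath_mul_ofPath]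
      exact dif_neg fun h => hv h.symm
    · intro h
      exact absurd (Finset.mem_univ _) h
  exact LinearMap.congr_fun key x

instance : Ring (PathAlgebra k V) :=
  { (inferInstance : AddCommGroup (PathAlgebra k V)) with
    mul := (· * ·)
    one := 1
    left_distrib := fun x y z => map_add (mulHom k V x) y z
    right_distrib := fun x y z => by simp only [mul_def, map_add, LinearMap.add_apply]
    zero_mul := fun x => by simp only [mul_def, map_zero, LinearMap.zero_apply]
    mul_zero := fun x => map_zero (mulHom k V x)
    mul_assoc := mul_assoc'
    one_mul := one_mul'
    mul_one := mul_one' }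

instance : Algebra k (PathAlgebra k V) :=
  Algebra.ofModule
    (fun r x y => by simp only [mul_def, map_smul, LinearMap.smul_apply])
    (fun r x y => by simp only [mul_def, map_smul])

/-- An ideal `I` of `kQ` is admissible if `J ^ m ⊆ I ⊆ J ^ 2` for some `m ≥ 2`, where `J` is the
ideal generated by the arrows; note that `J ^ m` is the span of the paths of length at least
`m`. -/
def IsAdmissible (I : Ideal (PathAlgebra k V)) : Prop :=
  (∀ x ∈ I, ∀ p : AllPaths V, coeff x p ≠ 0 → 2 ≤ p.length) ∧
    ∃ m : ℕ, 2 ≤ m ∧ ∀ p : AllPaths V, m ≤ p.length → ofPath k p ∈ I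

/-- The (not unital) ring homomorphism `kQ → kQ'` induced by a morphism of quivers `Q → Q'` that
is injective on vertices. -/
def map {W : Type u} [Quiver.{u} W] [Fintype W] (F : V ⥤q W) (hF : Function.Injective F.obj) :
    PathAlgebra k V →ₙ+* PathAlgebra k W where
  toFun := lift fun p => ofPath k ⟨F.obj p.1, F.obj p.2.1, F.mapPath p.2.2⟩
  map_zero' := map_zero _
  map_add' := map_add _
  map_mul' := by
    intro x y
    have key : (LinearMap.llcomp k _ _ _
          (lift fun p => ofPath k ⟨F.obj p.1, F.obj p.2.1, F.mapPath p.2.2⟩)).comp (mulHom k V) =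
        (mulHom k W).compl₁₂
          (lift fun p => ofPath k ⟨F.obj p.1, F.obj p.2.1, F.mapPath p.2.2⟩)
          (lift fun p => ofPath k ⟨F.obj p.1, F.obj p.2.1, F.mapPath p.2.2⟩) := by
      refine hom_ext fun p => hom_ext fun q => ?_
      simp only [LinearMap.comp_apply, LinearMap.llcomp_apply, LinearMap.compl₁₂_apply, ← mul_def,
        ofPath_mul_ofPath, lift_ofPath]
      obtain ⟨a, b, p⟩ := p
      obtain ⟨c, d, q⟩ := q
      by_cases h : b = c
      · subst h
        simp [mulPath, lift_ofPath, AllPaths.comp]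
      · have h' : F.obj b ≠ F.obj c := fun e => h (hF e)
        simp [mulPath, h, h']
    exact LinearMap.congr_fun (LinearMap.congr_fun key x) y

end PathAlgebra

/-! ## The quiver of the square algebra -/

/-- The vertices of the quiver `Q_C`: those of `Q_A` (left) and those of `Q_B` (right). The
parameters `J` and `K` list the arrows from `Q_A` to `Q_B` and those from `Q_B` to `Q_A`. -/
structure SquareQuiver {VA VB : Type u} (J : VA → VB → Type u) (K : VB → VA → Type u) where
  /-- the underlying vertex of `Q_A` or of `Q_B` -/
  vertex : VA ⊕ VB

namespace SquareQuiver

variable {VA VB : Type u} [Quiver.{u} VA] [Quiver.{u} VB]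
  (J : VA → VB → Type u) (K : VB → VA → Type u)

instance [Fintype VA] [Fintype VB] : Fintype (SquareQuiver J K) :=
  Fintype.ofEquiv (VA ⊕ VB) ⟨fun v => ⟨v⟩, fun v => v.vertex, fun _ => rfl, fun _ => rfl⟩

/-- The arrows of `Q_C`: those of `Q_A`, those of `Q_B`, the arrows `α_j` from `Q_A` to `Q_B`
and the arrows `β_k` from `Q_B` to `Q_A`. -/
inductive Arrow : SquareQuiver J K → SquareQuiver J K → Type u
  | inA {a a' : VA} (f : a ⟶ a') : Arrow ⟨Sum.inl a⟩ ⟨Sum.inl a'⟩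
  | inB {b b' : VB} (g : b ⟶ b') : Arrow ⟨Sum.inr b⟩ ⟨Sum.inr b'⟩
  | ofJ {a : VA} {b : VB} (j : J a b) : Arrow ⟨Sum.inl a⟩ ⟨Sum.inr b⟩
  | ofK {b : VB} {a : VA} (l : K b a) : Arrow ⟨Sum.inr b⟩ ⟨Sum.inl a⟩

instance : Quiver.{u} (SquareQuiver J K) := ⟨Arrow J K⟩

/-- The inclusion of `Q_A`. -/
def inclA : VA ⥤q SquareQuiver J K where
  obj a := ⟨Sum.inl a⟩
  map f := Arrow.inA f

/-- The inclusion of `Q_B`. -/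
def inclB : VB ⥤q SquareQuiver J K where
  obj b := ⟨Sum.inr b⟩
  map g := Arrow.inB g

theorem inclA_injective : Function.Injective (inclA J K).obj := fun _ _ h =>
  Sum.inl_injective (congrArg vertex h)

theorem inclB_injective : Function.Injective (inclB J K).obj := fun _ _ h =>
  Sum.inr_injective (congrArg vertex h)

variable {J K}

/-- The arrow `α_j` as an arrow of `Q_C`. -/
def arrowJ {a : VA} {b : VB} (j : J a b) :
    (⟨Sum.inl a⟩ : SquareQuiver J K) ⟶ ⟨Sum.inr b⟩ := Arrow.ofJ j

/-- The arrow `β_k` as an arrow of `Q_C`. -/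
def arrowK {b : VB} {a : VA} (l : K b a) :
    (⟨Sum.inr b⟩ : SquareQuiver J K) ⟶ ⟨Sum.inl a⟩ := Arrow.ofK l

variable (k : Type u) [Field k] [Fintype VA] [Fintype VB] (J K)

/-- `kQ_A → kQ_C`. -/
def algInclA : PathAlgebra k VA →ₙ+* PathAlgebra k (SquareQuiver J K) :=
  PathAlgebra.map (inclA J K) (inclA_injective J K)

/-- `kQ_B → kQ_C`. -/
def algInclB : PathAlgebra k VB →ₙ+* PathAlgebra k (SquareQuiver J K) :=
  PathAlgebra.map (inclB J K) (inclB_injective J K)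

/-- The generators `α α_j`, `β β_k`, `α_j β_k`, `β_k α_j` (for `α` an arrow of `Q_A`, `β` an arrow
of `Q_B`) of the mixed part of the ideal of relations. Only composable pairs are listed, the other
products being zero. -/
inductive MixedRelation : PathAlgebra k (SquareQuiver J K) → Prop
  | arrowA_J {a a' : VA} {b : VB} (f : a ⟶ a') (j : J a' b) : MixedRelation
      (PathAlgebra.arrow k ((inclA J K).map f) * PathAlgebra.arrow k (arrowJ j))
  | arrowB_K {b b' : VB} {a : VA} (g : b ⟶ b') (l : K b' a) : MixedRelation
      (PathAlgebra.arrow k ((inclB J K).map g) * PathAlgebra.arrow k (arrowK l))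
  | J_K {a a' : VA} {b : VB} (j : J a b) (l : K b a') : MixedRelation
      (PathAlgebra.arrow k (arrowJ j) * PathAlgebra.arrow k (arrowK l))
  | K_J {b b' : VB} {a : VA} (l : K b a) (j : J a b') : MixedRelation
      (PathAlgebra.arrow k (arrowK l) * PathAlgebra.arrow k (arrowJ j))

end SquareQuiver

/-! ## Modules, syzygies and the group `K₀`

A right module over an algebra `A` is a left module over `Aᵐᵒᵖ`; the notions of this section are
stated for left modules over a ring `R`, to be used for `R = Aᵐᵒᵖ`. -/

section Modules

variable {R : Type u} [Ring R]

/-- The finitistic dimension of a class of finitely generated modules: the supremum of the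
projective dimensions of its members of finite projective dimension. -/
def findimOn (X : Set (FGModuleCat.{u} R)) : WithBot ℕ∞ :=
  ⨆ M : {M : FGModuleCat.{u} R // M ∈ X ∧ projectiveDimension M.obj < ⊤},
    projectiveDimension M.1.obj

variable (R) in
/-- The (small) finitistic dimension of a ring. -/
def findim : WithBot ℕ∞ := findimOn (Set.univ : Set (FGModuleCat.{u} R))

/-- `f : P → M` is a projective cover: `P` is projective, and `f` is onto with superfluous
kernel. -/
structure IsProjectiveCover {P M : ModuleCat.{u} R} (f : P →ₗ[R] M) : Prop where
  projective : Module.Projective R P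
  surjective : Function.Surjective f
  superfluous : ∀ N : Submodule R P, N ⊔ LinearMap.ker f = ⊤ → N = ⊤

/-- `N ≅ Ω(M)`, the kernel of a projective cover of `M`. -/
def IsSyzygy (M N : ModuleCat.{u} R) : Prop :=
  ∃ (P : ModuleCat.{u} R) (f : P →ₗ[R] M),
    IsProjectiveCover f ∧ Nonempty (N ≃ₗ[R] LinearMap.ker f)

/-- `N ≅ Ωⁿ(M)`. -/
def IsIteratedSyzygy : ℕ → ModuleCat.{u} R → ModuleCat.{u} R → Prop
  | 0, M, N => Nonempty (N ≃ₗ[R] M)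
  | n + 1, M, N => ∃ L : ModuleCat.{u} R, IsIteratedSyzygy n M L ∧ IsSyzygy L N

/-- The `Ω`-orbit `{Ωⁿ(M)}_{n ≥ 0}` of a module. -/
def syzygyOrbit (M : ModuleCat.{u} R) : Set (ModuleCat.{u} R) :=
  {N | ∃ n : ℕ, IsIteratedSyzygy n M N}

/-- `L` is a direct summand of `M`. -/
def IsDirectSummand (L M : ModuleCat.{u} R) : Prop :=
  ∃ L' : ModuleCat.{u} R, Nonempty (M ≃ₗ[R] L × L')

/-- `add X`: the finite direct sums of direct summands of members of `X`. -/
def addClosure (X : Set (ModuleCat.{u} R)) : Set (ModuleCat.{u} R) :=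
  {N | ∃ (m : ℕ) (L : Fin m → ModuleCat.{u} R),
    (∀ i, ∃ M ∈ X, IsDirectSummand (L i) M) ∧ Nonempty (N ≃ₗ[R] (∀ i, L i))}

/-- `M` is the direct sum of all simple modules, one from each isomorphism class. -/
def IsSumOfSimples (M : ModuleCat.{u} R) : Prop :=
  ∃ (m : ℕ) (S : Fin m → ModuleCat.{u} R),
    (∀ i, IsSimpleModule R (S i)) ∧
    (∀ i j, Nonempty (S i ≃ₗ[R] S j) → i = j) ∧
    (∀ T : ModuleCat.{u} R, IsSimpleModule R T → ∃ i, Nonempty (T ≃ₗ[R] S i)) ∧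
    Nonempty (M ≃ₗ[R] (∀ i, S i))

variable (R) in
/-- The relations of `K₀`: `[M] - [M'] - [M'']` for `M ≅ M' ⊕ M''`, and `[P]` for `P`
projective. -/
inductive K0Relation : FreeAbelianGroup (FGModuleCat.{u} R) → Prop
  | sum (M M' M'' : FGModuleCat.{u} R) (h : Nonempty (M ≃ₗ[R] M' × M'')) :
      K0Relation (FreeAbelianGroup.of M - FreeAbelianGroup.of M' - FreeAbelianGroup.of M'')
  | proj (P : FGModuleCat.{u} R) (h : Module.Projective R P) :
      K0Relation (FreeAbelianGroup.of P)

variable (R) in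
/-- The abelian group generated by the symbols `[M]`, for `M` a finitely generated module, modulo
the relations above. -/
abbrev K0 : Type (u + 1) :=
  FreeAbelianGroup (FGModuleCat.{u} R) ⧸
    AddSubgroup.closure {x : FreeAbelianGroup (FGModuleCat.{u} R) | K0Relation R x}

namespace K0

/-- The class `[M]`. -/
def mk (M : FGModuleCat.{u} R) : K0 R := QuotientAddGroup.mk (FreeAbelianGroup.of M)

/-- The class of a finitely generated module that is not bundled. -/
def cls (R : Type u) [Ring R] (M : Type u) [AddCommGroup M] [Module R M] [Module.Finite R M] :
    K0 R := mk (⟨ModuleCat.of R M, ‹_›⟩ : FGModuleCat.{u} R)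

theorem cls_prod {M M' M'' : Type u} [AddCommGroup M] [Module R M] [Module.Finite R M]
    [AddCommGroup M'] [Module R M'] [Module.Finite R M']
    [AddCommGroup M''] [Module R M''] [Module.Finite R M''] (e : M ≃ₗ[R] M' × M'') :
    cls R M = cls R M' + cls R M'' := by
  have h : (QuotientAddGroup.mk (_ - _ - _) : K0 R) = 0 :=
    (QuotientAddGroup.eq_zero_iff _).2 (AddSubgroup.subset_closure
      (K0Relation.sum (⟨ModuleCat.of R M, ‹_›⟩ : FGModuleCat.{u} R)
        (⟨ModuleCat.of R M', ‹_›⟩ : FGModuleCat.{u} R)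
        (⟨ModuleCat.of R M'', ‹_›⟩ : FGModuleCat.{u} R) ⟨e⟩))
  rw [QuotientAddGroup.mk_sub, QuotientAddGroup.mk_sub, sub_sub, sub_eq_zero] at h
  exact h

theorem cls_proj (P : Type u) [AddCommGroup P] [Module R P] [Module.Finite R P]
    [hP : Module.Projective R P] : cls R P = 0 :=
  (QuotientAddGroup.eq_zero_iff _).2 (AddSubgroup.subset_closure
    (K0Relation.proj (⟨ModuleCat.of R P, ‹_›⟩ : FGModuleCat.{u} R) hP))

theorem cls_congr {M M' : Type u} [AddCommGroup M] [Module R M] [Module.Finite R M]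
    [AddCommGroup M'] [Module R M'] [Module.Finite R M'] (e : M ≃ₗ[R] M') :
    cls R M = cls R M' := by
  have h := cls_prod (M := M) (M' := M') (M'' := PUnit.{u + 1})
    (e.trans (LinearEquiv.prodUnique (R := R) (M := M') (M₂ := PUnit.{u + 1})).symm)
  rwa [cls_proj (PUnit.{u + 1}), add_zero] at h

variable {M M' P P' : Type u} [AddCommGroup M] [Module R M] [AddCommGroup M'] [Module R M']
  [AddCommGroup P] [Module R P] [AddCommGroup P'] [Module R P']

/-- If `g : P' → M` is onto and `P` is projective, then the fibre product of `f : P → M` and `g`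
is isomorphic to `P ⊕ ker g`. -/
theorem exists_fibre_equiv (f : P →ₗ[R] M) (g : P' →ₗ[R] M) (hg : Function.Surjective g)
    [Module.Projective R P] :
    Nonempty ((LinearMap.eqLocus (f ∘ₗ LinearMap.fst R P P') (g ∘ₗ LinearMap.snd R P P')) ≃ₗ[R]
      LinearMap.ker g × P) := by
  obtain ⟨s, hs⟩ := Module.projective_lifting_property g f hg
  have hs' : ∀ x, g (s x) = f x := fun x => LinearMap.congr_fun hs x
  refine ⟨LinearEquiv.ofLinearMap
    (LinearMap.prod
      (LinearMap.codRestrict (LinearMap.ker g)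
        ((LinearMap.snd R P P' - s ∘ₗ LinearMap.fst R P P') ∘ₗ Submodule.subtype _) ?_)
      (LinearMap.fst R P P' ∘ₗ Submodule.subtype _))
    (LinearMap.codRestrict _
      (LinearMap.prod (LinearMap.snd R _ P)
        ((Submodule.subtype _) ∘ₗ LinearMap.fst R _ P + s ∘ₗ LinearMap.snd R _ P)) ?_) ?_ ?_⟩
  · rintro ⟨⟨x, y⟩, h⟩
    have h' : f x = g y := h
    simp [hs', h']
  · rintro ⟨⟨y, hy⟩, x⟩
    have hy' : g y = 0 := hy
    simp [LinearMap.mem_eqLocus, hs', hy']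
  · ext <;> simp
  · ext x <;> simp

/-- Schanuel's lemma in `K₀`. -/
theorem cls_ker_eq [IsNoetherianRing R] [Module.Finite R P] [Module.Finite R P']
    [Module.Projective R P] [Module.Projective R P'] (f : P →ₗ[R] M) (g : P' →ₗ[R] M)
    (hf : Function.Surjective f) (hg : Function.Surjective g) :
    cls R (LinearMap.ker f) = cls R (LinearMap.ker g) := by
  obtain ⟨e⟩ := exists_fibre_equiv f g hg
  obtain ⟨e'⟩ := exists_fibre_equiv g f hf
  let t : (LinearMap.eqLocus (f ∘ₗ LinearMap.fst R P P') (g ∘ₗ LinearMap.snd R P P')) ≃ₗ[R]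
      (LinearMap.eqLocus (g ∘ₗ LinearMap.fst R P' P) (f ∘ₗ LinearMap.snd R P' P)) :=
    LinearEquiv.ofSubmodules (LinearEquiv.prodComm R P P') _ _ (by
      ext ⟨x, y⟩
      simp only [Submodule.mem_map, LinearMap.mem_eqLocus]
      constructor
      · rintro ⟨⟨a, b⟩, h, h2⟩
        cases h2
        exact h.symm
      · intro h
        exact ⟨(y, x), h.symm, rfl⟩)
  have h1 := cls_prod e
  have h2 := cls_prod e'
  rw [cls_proj P, add_zero] at h1
  rw [cls_proj P', add_zero] at h2
  rw [← h1, ← h2]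
  exact (cls_congr t).symm ▸ rfl

/-- A product of kernels as a submodule is the product of the kernels. -/
def prodKerEquiv (f : P →ₗ[R] M) (g : P' →ₗ[R] M') :
    ((LinearMap.ker f).prod (LinearMap.ker g)) ≃ₗ[R] LinearMap.ker f × LinearMap.ker g where
  toFun x := (⟨x.1.1, x.2.1⟩, ⟨x.1.2, x.2.2⟩)
  map_add' _ _ := rfl
  map_smul' _ _ := rfl
  invFun y := ⟨(y.1.1, y.2.1), y.1.2, y.2.2⟩

/-- `[ker f]` for a chosen surjection `f` from a free module of finite rank onto `M`. -/
def syzygyClass [IsNoetherianRing R] (M : FGModuleCat.{u} R) : K0 R :=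
  cls R (LinearMap.ker (Module.Finite.exists_fin' R M).choose_spec.choose)

theorem syzygyClass_eq [IsNoetherianRing R] (M : FGModuleCat.{u} R) [Module.Finite R P]
    [Module.Projective R P] (f : P →ₗ[R] M) (hf : Function.Surjective f) :
    syzygyClass M = cls R (LinearMap.ker f) :=
  cls_ker_eq _ _ (Module.Finite.exists_fin' R M).choose_spec.choose_spec hf

variable (R) in
/-- The endomorphism `Ω̄` of `K₀` with `Ω̄[M] = [Ω M]`. As projective modules have class zero, the
kernel of any surjection from a finitely generated projective module onto `M` serves as well as the
kernel of a projective cover. -/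
def omegaBar [IsNoetherianRing R] : AddMonoid.End (K0 R) :=
  QuotientAddGroup.lift _ (FreeAbelianGroup.lift (syzygyClass (R := R))) (by
    rw [AddSubgroup.closure_le]
    rintro x hx
    change FreeAbelianGroup.lift syzygyClass x = 0
    cases hx with
    | sum M M' M'' h =>
      obtain ⟨e⟩ := h
      obtain ⟨n, f, hf⟩ := Module.Finite.exists_fin' R M'
      obtain ⟨n', f', hf'⟩ := Module.Finite.exists_fin' R M''
      have hs : Function.Surjective (e.symm.toLinearMap ∘ₗ f.prodMap f') :=
        e.symm.surjective.comp (Prod.map_surjective.2 ⟨hf, hf'⟩)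
      have hk : LinearMap.ker (e.symm.toLinearMap ∘ₗ f.prodMap f') =
          (LinearMap.ker f).prod (LinearMap.ker f') := by
        rw [LinearEquiv.ker_comp, LinearMap.ker_prodMap]
      simp only [map_sub, FreeAbelianGroup.lift_apply_of]
      rw [syzygyClass_eq M _ hs, syzygyClass_eq M' f hf, syzygyClass_eq M'' f' hf',
        cls_prod ((LinearEquiv.ofEq _ _ hk).trans (prodKerEquiv f f'))]
      abel
    | proj P h =>
      rw [FreeAbelianGroup.lift_apply_of,
        syzygyClass_eq P (LinearMap.id : P →ₗ[R] P) Function.surjective_id]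
      rw [cls_congr (LinearEquiv.ofEq _ _ LinearMap.ker_id)]
      exact cls_proj _)

/-- A projective cover of a finitely generated module is finitely generated. -/
theorem finite_of_isProjectiveCover {P M : ModuleCat.{u} R} {f : P →ₗ[R] M}
    (hf : IsProjectiveCover f) [Module.Finite R M] : Module.Finite R P := by
  obtain ⟨n, p, hp⟩ := Module.Finite.exists_fin' R M
  obtain ⟨s, hs⟩ := Module.projective_lifting_property f p hf.surjective
  have h : LinearMap.range s = ⊤ := by
    refine hf.superfluous _ ?_
    rw [eq_top_iff]
    rintro x -
    obtain ⟨y, hy⟩ := hp (f x)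
    have hy' : f (s y) = f x := (LinearMap.congr_fun hs y).trans hy
    have hx : x - s y ∈ LinearMap.ker f := by
      rw [LinearMap.mem_ker, map_sub, hy', sub_self]
    have := Submodule.add_mem_sup (LinearMap.mem_range_self s y) hx
    rwa [add_sub_cancel] at this
  exact Module.Finite.of_surjective s (LinearMap.range_eq_top.1 h)

/-- `Ω̄` is the map induced by the syzygy: `Ω̄[M] = [Ω(M)]`. -/
theorem omegaBar_mk [IsNoetherianRing R] (M N : FGModuleCat.{u} R) (h : IsSyzygy M.obj N.obj) :
    omegaBar R (mk M) = mk N := by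
  obtain ⟨P, f, hf, ⟨e⟩⟩ := h
  have : Module.Finite R M.obj := M.property
  have : Module.Finite R N.obj := N.property
  have := finite_of_isProjectiveCover hf
  have := hf.projective
  have h1 : omegaBar R (mk M) = syzygyClass M := FreeAbelianGroup.lift_apply_of _ _
  rw [h1, syzygyClass_eq M f hf.surjective]
  exact (cls_congr e).symm

/-- A subgroup `G` of `K₀` is syzygy finite if `Ω̄ⁿ(G)` is finitely generated for some `n ≥ 0`. -/
def SyzygyFinite [IsNoetherianRing R] (G : AddSubgroup (K0 R)) : Prop :=
  ∃ n : ℕ, (G.map (omegaBar R ^ n)).FG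

end K0

end Modules

/-! ## Restriction to an idempotent part

In the application `f : R → S` is the non-unital homomorphism `A → C` (or its opposite), with
`f 1 = e_A` the sum of the trivial paths at the vertices of `Q_A`. -/

section Corner

variable {R S T : Type u} [Ring R] [Ring S] [Ring T]

/-- The subgroup `f(1) M` of an `S`-module `M`. -/
def corner (f : R →ₙ+* S) (M : ModuleCat.{u} S) : AddSubgroup M where
  carrier := {m | f 1 • m = m}
  zero_mem' := smul_zero _
  add_mem' {a b} ha hb := by
    have ha' : f 1 • a = a := ha
    have hb' : f 1 • b = b := hb
    change f 1 • (a + b) = a + b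
    rw [smul_add, ha', hb']
  neg_mem' {a} ha := by
    have ha' : f 1 • a = a := ha
    change f 1 • (-a) = -a
    rw [smul_neg, ha']

/-- `f(1) M` is an `R`-module through `f`. -/
instance (f : R →ₙ+* S) (M : ModuleCat.{u} S) : Module R (corner f M) where
  smul r m := ⟨f r • m.1, by
    change f 1 • f r • m.1 = f r • m.1
    rw [smul_smul, ← map_mul, one_mul]⟩
  one_smul m := Subtype.ext m.2
  mul_smul r r' m := Subtype.ext (by
    change f (r * r') • m.1 = f r • f r' • m.1
    rw [map_mul, mul_smul])
  smul_zero r := Subtype.ext (smul_zero (f r))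
  smul_add r m m' := Subtype.ext (smul_add (f r) m.1 m'.1)
  add_smul r r' m := Subtype.ext (by
    change f (r + r') • m.1 = f r • m.1 + f r' • m.1
    rw [map_add, add_smul])
  zero_smul m := Subtype.ext (by
    change f 0 • m.1 = 0
    rw [map_zero, zero_smul])

/-- The restriction functor `Π_A : mod C → mod A` on objects: the part of a representation of `Q_C`
that lives on `Q_A`. -/
def restrictTo (f : R →ₙ+* S) (M : ModuleCat.{u} S) : ModuleCat.{u} R :=
  ModuleCat.of R (corner f M)

/-- `M` is the `R`-module `N` viewed as an `S`-module: `M` lives entirely on the part of `R`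
(so it is zero at the vertices outside `Q_A`), and is `N` there. -/
def IsExtensionByZero (f : R →ₙ+* S) (N : ModuleCat.{u} R) (M : ModuleCat.{u} S) : Prop :=
  (∀ m : M, f 1 • m = m) ∧ Nonempty (restrictTo f M ≃ₗ[R] N)

/-- The orbit `Orb_{Ω_A}(Π_A(Ω_C(B_0)))` of `A`-modules (up to isomorphism), where `B_0` is the sum
of the simple `B`-modules, viewed as a `C`-module; here `f : A → C` and `g : B → C`. -/
def mixedOrbit (f : R →ₙ+* S) (g : T →ₙ+* S) : Set (ModuleCat.{u} R) :=
  {N | ∃ (B₀ : ModuleCat.{u} T) (M W : ModuleCat.{u} S), IsSumOfSimples B₀ ∧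
    IsExtensionByZero g B₀ M ∧ IsSyzygy M W ∧ N ∈ syzygyOrbit (restrictTo f W)}

/-- The subgroup `𝒪 = [add Orb_{Ω_A}(Π_A(Ω_C(B_0))) × add Orb_{Ω_B}(Π_B(Ω_C(A_0)))]` of `K₀(C)`,
generated by the classes of the modules of the two subcategories, viewed as `C`-modules; here
`f : A → C` and `g : B → C`. -/
def orbitSubgroup (f : R →ₙ+* S) (g : T →ₙ+* S) : AddSubgroup (K0 S) :=
  AddSubgroup.closure
    ({x | ∃ (M : FGModuleCat.{u} S), ∃ N ∈ addClosure (mixedOrbit f g),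
        IsExtensionByZero f N M.obj ∧ x = K0.mk M} ∪
     {x | ∃ (M : FGModuleCat.{u} S), ∃ N ∈ addClosure (mixedOrbit g f),
        IsExtensionByZero g N M.obj ∧ x = K0.mk M})

/-- The homomorphism of quotient rings induced by a non-unital homomorphism. -/
def quotientMap {I : Ideal R} [I.IsTwoSided] {I' : Ideal S} [I'.IsTwoSided] (f : R →ₙ+* S)
    (h : ∀ x, x ∈ I → f x ∈ I') : (R ⧸ I) →ₙ+* (S ⧸ I') where
  toFun := QuotientAddGroup.lift I.toAddSubgroup
    (((Ideal.Quotient.mk I').toAddMonoidHom).comp f.toAddMonoidHom)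
    (fun x hx => Ideal.Quotient.eq_zero_iff_mem.2 (h x hx))
  map_zero' := map_zero _
  map_add' := map_add _
  map_mul' := by
    intro x y
    obtain ⟨x, rfl⟩ := Ideal.Quotient.mk_surjective x
    obtain ⟨y, rfl⟩ := Ideal.Quotient.mk_surjective y
    change Ideal.Quotient.mk I' (f (x * y)) = Ideal.Quotient.mk I' (f x) * Ideal.Quotient.mk I' (f y)
    rw [map_mul, map_mul]

end Corner

/-! ## Bound quiver algebras -/

/-- The opposite of the bound quiver algebra `kQ / I`, so that the right `kQ / I`-modules are the
left modules over this ring. -/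
abbrev BoundQuiverOp {k : Type u} [Field k] {V : Type u} [Quiver.{u} V] [Fintype V]
    (I : Ideal (PathAlgebra k V)) [I.IsTwoSided] : Type u := (PathAlgebra k V ⧸ I)ᵐᵒᵖ

/-- Finite dimensional algebras are noetherian. -/
instance {k : Type u} [Field k] {V : Type u} [Quiver.{u} V] [Fintype V]
    (I : Ideal (PathAlgebra k V)) [I.IsTwoSided] [FiniteDimensional k (PathAlgebra k V ⧸ I)] :
    IsNoetherianRing (BoundQuiverOp I) :=
  IsNoetherianRing.of_finite k _

end

/-! By the mixed relations, a nontrivial path followed by a path from one of the two vertex sets to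
the other is zero in `C`. So the off-diagonal parts `e_A C e_B` and `e_B C e_A` annihilate the
radical of `C`, hence every syzygy, and `Ω_C(M)` is the direct sum of an `A`-module and a `B`-module
(`IsDiagonalPair.exists_ker_parts`). By the symmetry of `A` and `B` it remains to bound the
projective dimension of an `A`-module `X` over `C`.

Let `P` be the projective cover of `X` over `C`. Then `P e_A` is the projective cover of `X` over
`A` (`projCover_corner`), while `P e_B` lies in the kernel, so `Ω_C(X) = Ω_A(X) ⊕ P e_B`. As `P`
depends only on the top of `X`, the module `P e_B` is a finite direct sum of summands of
`Π_B(Ω_C(A_0))` (`corner_cover_mem_addClosure`), and its class is in `𝒪`. Let `F` be the finitistic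
dimension of the modules with class in `𝒪`. If `X` has finite projective dimension over `C`, so have
all these summands, and induction gives `pd_C(X) ≤ pd_A(X) + 1 + F` (`projDimLT_of_corner`). The
same splitting gives `pd_A(X) ≤ pd_C(X)` (`projDimLT_corner`), so `pd_A(X) ≤ findim(A)`. The passage
from `M` to `Ω_C(M)` costs one more.

`F` is finite by an argument of Igusa-Todorov type (`K0.SyzygyFinite.exists_bound`): on a finitely
generated subgroup of `K₀` the kernels of the powers of `Ω̄` stabilise, and a module of class zero
is projective.

The proof is carried out for abstract rings satisfying `IsDiagonalPair`;
`IsMixedIdeal.isDiagonalPair` and `SquareQuiver.isMixedIdeal` connect this with bound quivers. -/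

/-! ## Projective covers -/

section Covers

variable {R : Type u} [Ring R]
variable {P P' M M' N : Type u} [AddCommGroup P] [Module R P] [AddCommGroup P'] [Module R P']
  [AddCommGroup M] [Module R M] [AddCommGroup M'] [Module R M'] [AddCommGroup N] [Module R N]

/-- Projective covers of modules that are not bundled. -/
abbrev ProjCover (p : P →ₗ[R] M) : Prop :=
  IsProjectiveCover (P := ModuleCat.of R P) (M := ModuleCat.of R M) p

/-- The cover is a minimal submodule of a free module among those that still map onto `M`.
Minimality makes the kernel superfluous, and it also yields a splitting of the free module. -/
theorem ProjCover.exists_cover [IsArtinianRing R] [IsNoetherianRing R] (M : Type u)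
    [AddCommGroup M] [Module R M] [Module.Finite R M] :
    ∃ (n : ℕ) (P : Submodule R (Fin n → R)) (p : P →ₗ[R] M), ProjCover p := by
  obtain ⟨n, π, hπ⟩ := Module.Finite.exists_fin' R M
  obtain ⟨P, hP, hmin⟩ := (wellFounded_lt (α := Submodule R (Fin n → R))).has_min
    {Q | Function.Surjective (π ∘ₗ Q.subtype)}
    ⟨⊤, fun m => by obtain ⟨x, hx⟩ := hπ m; exact ⟨⟨x, trivial⟩, hx⟩⟩
  have hmin' : ∀ Q : Submodule R P, Function.Surjective ((π ∘ₗ P.subtype) ∘ₗ Q.subtype) →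
      Q = ⊤ := by
    intro Q hQ
    have h1 : Function.Surjective (π ∘ₗ (Q.map P.subtype).subtype) := by
      intro m
      obtain ⟨x, hx⟩ := hQ m
      exact ⟨⟨x.1.1, x.1, x.2, rfl⟩, hx⟩
    have h2 : Q.map P.subtype ≤ P := Submodule.map_subtype_le P Q
    have h3 : Q.map P.subtype = P := by
      by_contra h
      exact hmin _ h1 (lt_of_le_of_ne h2 h)
    exact Submodule.map_injective_of_injective P.injective_subtype
      (h3.trans (Submodule.map_subtype_top P).symm)
  have hsup : ∀ Q : Submodule R P, Q ⊔ LinearMap.ker (π ∘ₗ P.subtype) = ⊤ → Q = ⊤ := by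
    intro Q hQ
    refine hmin' Q fun m => ?_
    obtain ⟨x, hx⟩ := hP m
    obtain ⟨y, hy, z, hz, rfl⟩ := Submodule.mem_sup.1 (hQ ▸ Submodule.mem_top : x ∈ _)
    refine ⟨⟨y, hy⟩, ?_⟩
    rw [map_add, LinearMap.mem_ker.1 hz, add_zero] at hx
    exact hx
  refine ⟨n, P, π ∘ₗ P.subtype, ⟨?_, hP, hsup⟩⟩
  -- The restriction of `s` to `P` is onto by minimality, hence an automorphism as `P` is
  -- noetherian; so `P` is a retract of the free module.
  obtain ⟨s, hs⟩ := Module.projective_lifting_property (π ∘ₗ P.subtype) π hP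
  have h1 : LinearMap.range (s ∘ₗ P.subtype) = ⊤ := by
    refine hmin' _ fun m => ?_
    obtain ⟨x, hx⟩ := hP m
    exact ⟨⟨_, LinearMap.mem_range_self _ x⟩, (LinearMap.congr_fun hs x.1).trans hx⟩
  have h2 : Function.Injective (s ∘ₗ P.subtype) :=
    IsNoetherian.injective_of_surjective_endomorphism _ (LinearMap.range_eq_top.1 h1)
  let e := LinearEquiv.ofBijective (s ∘ₗ P.subtype) ⟨h2, LinearMap.range_eq_top.1 h1⟩
  exact Module.Projective.of_split (P.subtype ∘ₗ e.symm.toLinearMap) s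
    (LinearMap.ext fun x => e.apply_symm_apply x)

/-- Nakayama: a proper submodule lies in a maximal one, which also contains the radical. -/
theorem IsNoetherian.eq_top_of_sup_eq_top [IsNoetherian R M] {K Q : Submodule R M}
    (hK : K ≤ Module.jacobson R M) (h : Q ⊔ K = ⊤) : Q = ⊤ := by
  rcases eq_top_or_exists_le_coatom Q with h' | ⟨m, hm, hQ⟩
  · exact h'
  · refine absurd (top_le_iff.1 (h ▸ sup_le hQ (hK.trans ?_))) hm.1
    exact sInf_le hm

namespace ProjCover

theorem of_ker_le_jacobson [IsNoetherian R P] [Module.Projective R P] {p : P →ₗ[R] M}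
    (hs : Function.Surjective p) (hk : LinearMap.ker p ≤ Module.jacobson R P) : ProjCover p :=
  ⟨‹_›, hs, fun _ h => IsNoetherian.eq_top_of_sup_eq_top hk h⟩

/-- A maximal submodule not containing the kernel would span the whole module together with it. With
`of_ker_le_jacobson`, superfluity becomes a condition that can be checked on elements, which handles
direct sums. -/
theorem ker_le_jacobson {p : P →ₗ[R] M} (hp : ProjCover p) :
    LinearMap.ker p ≤ Module.jacobson R P := by
  refine le_sInf fun m hm => ?_
  by_contra h
  exact hm.1 (hp.superfluous m (hm.2 _ (left_lt_sup.2 h)))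

theorem finite [Module.Finite R M] {p : P →ₗ[R] M} (hp : ProjCover p) : Module.Finite R P :=
  have : Module.Finite R (ModuleCat.of R M) := ‹_›
  K0.finite_of_isProjectiveCover hp

theorem comp_equiv {p : P →ₗ[R] M} (hp : ProjCover p) (e : M ≃ₗ[R] M') :
    ProjCover (e.toLinearMap ∘ₗ p) :=
  ⟨hp.projective, e.surjective.comp hp.surjective, fun N h => hp.superfluous N (by
    rwa [LinearEquiv.ker_comp] at h)⟩

theorem comp {p : P →ₗ[R] M} (hp : ProjCover p) {q : M →ₗ[R] N} (hq : Function.Surjective q)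
    (hs : ∀ Q : Submodule R M, Q ⊔ LinearMap.ker q = ⊤ → Q = ⊤) : ProjCover (q ∘ₗ p) := by
  refine ⟨hp.projective, hq.comp hp.surjective, fun Q hQ => hp.superfluous Q ?_⟩
  have h1 : Q.map p = ⊤ := by
    refine hs _ (eq_top_iff.2 fun m _ => ?_)
    obtain ⟨x, rfl⟩ := hp.surjective m
    obtain ⟨y, hy, z, hz, rfl⟩ := Submodule.mem_sup.1 (hQ ▸ Submodule.mem_top : x ∈ _)
    exact Submodule.mem_sup.2 ⟨p y, ⟨y, hy, rfl⟩, p z, hz, (map_add p y z).symm⟩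
  refine eq_top_iff.2 fun x _ => ?_
  obtain ⟨y, hy, hxy⟩ := (h1 ▸ Submodule.mem_top : p x ∈ Q.map p)
  refine Submodule.mem_sup.2 ⟨y, hy, x - y, ?_, add_sub_cancel _ _⟩
  exact LinearMap.mem_ker.2 ((map_sub p x y).trans (sub_eq_zero.2 hxy.symm))

theorem exists_equiv {p : P →ₗ[R] M} {p' : P' →ₗ[R] M} (hp : ProjCover p) (hp' : ProjCover p') :
    ∃ e : P ≃ₗ[R] P', ∀ x, p' (e x) = p x := by
  -- Any map between covers that is compatible with the maps to `M` is onto: its range and the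
  -- superfluous kernel span the target.
  have aux : ∀ {Q Q' : Type u} [AddCommGroup Q] [Module R Q] [AddCommGroup Q'] [Module R Q']
      {q : Q →ₗ[R] M} {q' : Q' →ₗ[R] M}, ProjCover q → ProjCover q' → ∀ s : Q →ₗ[R] Q',
      q' ∘ₗ s = q → Function.Surjective s := by
    intro Q Q' _ _ _ _ q q' hq hq' s hs
    refine LinearMap.range_eq_top.1 (hq'.superfluous _ (eq_top_iff.2 fun x _ => ?_))
    obtain ⟨y, hy⟩ := hq.surjective (q' x)
    refine Submodule.mem_sup.2 ⟨s y, LinearMap.mem_range_self s y, x - s y, ?_,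
      add_sub_cancel _ _⟩
    have h2 : q' (s y) = q' x := (LinearMap.congr_fun hs y).trans hy
    exact LinearMap.mem_ker.2 ((map_sub q' x (s y)).trans (sub_eq_zero.2 h2.symm))
  have hpp : Module.Projective R P := hp.projective
  have hpp' : Module.Projective R P' := hp'.projective
  obtain ⟨s, hs⟩ := Module.projective_lifting_property p' p hp'.surjective
  have h1 := aux hp hp' s hs
  -- The section `t` is again compatible with the maps to `M`, hence onto, and this makes `s`
  -- injective.
  obtain ⟨t, ht⟩ := Module.projective_lifting_property s LinearMap.id h1
  have h2 := aux hp' hp t (by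
    rw [← hs, LinearMap.comp_assoc, ht, LinearMap.comp_id])
  have h3 : Function.Injective s := by
    intro x y hxy
    obtain ⟨x, rfl⟩ := h2 x
    obtain ⟨y, rfl⟩ := h2 y
    have hx : s (t x) = x := LinearMap.congr_fun ht x
    have hy : s (t y) = y := LinearMap.congr_fun ht y
    rw [hx, hy] at hxy
    rw [hxy]
  exact ⟨LinearEquiv.ofBijective s ⟨h3, h1⟩, LinearMap.congr_fun hs⟩

theorem ker_equiv {p : P →ₗ[R] M} {p' : P' →ₗ[R] M'} (hp : ProjCover p) (hp' : ProjCover p')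
    (e : M ≃ₗ[R] M') : Nonempty (LinearMap.ker p ≃ₗ[R] LinearMap.ker p') := by
  obtain ⟨t, ht⟩ := (hp.comp_equiv e).exists_equiv hp'
  refine ⟨LinearEquiv.ofSubmodules t _ _ ?_⟩
  ext x
  constructor
  · rintro ⟨y, hy, rfl⟩
    exact (ht y).trans ((congrArg e hy).trans (map_zero e))
  · intro hx
    refine ⟨t.symm x, ?_, t.apply_symm_apply x⟩
    have := ht (t.symm x)
    rw [t.apply_symm_apply] at this
    exact e.injective ((this.symm.trans hx).trans (map_zero e).symm)

theorem pi {ι : Type} [Finite ι] {P M : ι → Type u} [∀ i, AddCommGroup (P i)]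
    [∀ i, Module R (P i)] [∀ i, AddCommGroup (M i)] [∀ i, Module R (M i)]
    [IsNoetherianRing R] [∀ i, Module.Finite R (M i)] {p : ∀ i, P i →ₗ[R] M i}
    (hp : ∀ i, ProjCover (p i)) :
    ProjCover (LinearMap.piMap p) := by
  classical
  have := Fintype.ofFinite ι
  have hP : ∀ i, Module.Projective R (P i) := fun i => (hp i).projective
  have hF : ∀ i, Module.Finite R (P i) := fun i => (hp i).finite
  have : Module.Projective R (∀ i, P i) :=
    Module.Projective.of_equiv (DFinsupp.linearEquivFunOnFintype (R := R) (M := P))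
  refine of_ker_le_jacobson (Function.Surjective.piMap fun i => (hp i).surjective) ?_
  intro x hx
  have hx' : ∀ i, x i ∈ Module.jacobson R (P i) := fun i =>
    (hp i).ker_le_jacobson (congrFun hx i)
  rw [← Finset.univ_sum_single x]
  exact Submodule.sum_mem _ fun i _ =>
    Module.le_comap_jacobson (LinearMap.single R P i) (hx' i)

theorem prod [IsNoetherianRing R] [Module.Finite R M] [Module.Finite R M'] {p : P →ₗ[R] M}
    {p' : P' →ₗ[R] M'} (hp : ProjCover p) (hp' : ProjCover p') : ProjCover (p.prodMap p') := by
  have : Module.Projective R P := hp.projective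
  have : Module.Finite R P := hp.finite
  have : Module.Projective R P' := hp'.projective
  have : Module.Finite R P' := hp'.finite
  refine of_ker_le_jacobson (Prod.map_surjective.2 ⟨hp.surjective, hp'.surjective⟩) ?_
  rintro ⟨x, y⟩ hx
  rw [LinearMap.ker_prodMap] at hx
  have h : (x, y) = LinearMap.inl R P P' x + LinearMap.inr R P P' y := by simp
  rw [h]
  exact Submodule.add_mem _
    (Module.le_comap_jacobson (LinearMap.inl R P P') (hp.ker_le_jacobson hx.1))
    (Module.le_comap_jacobson (LinearMap.inr R P P') (hp'.ker_le_jacobson hx.2))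

end ProjCover

/-- An element of a ring that annihilates its Jacobson radical from the left annihilates the
kernel of every projective cover. -/
theorem ProjCover.smul_eq_zero_of_mem_ker [Module.Finite R P] {p : P →ₗ[R] M} (hp : ProjCover p)
    {c : R} (hc : ∀ x ∈ Ring.jacobson R, c * x = 0) {x : P} (hx : x ∈ LinearMap.ker p) :
    c • x = 0 := by
  have : Module.Projective R P := hp.projective
  obtain ⟨n, π, hπ⟩ := Module.Finite.exists_fin' R P
  obtain ⟨s, hs⟩ := Module.projective_lifting_property π LinearMap.id hπ
  -- Inside the free module the radical has its coordinates in the radical of `R`, where `hc`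
  -- applies.
  have h1 : s x ∈ Module.jacobson R (Fin n → R) :=
    Module.le_comap_jacobson s (hp.ker_le_jacobson hx)
  have h2 : c • s x = 0 := by
    ext i
    exact hc _ (Module.jacobson_pi_le R _ h1 i trivial)
  have h3 : π (s x) = x := LinearMap.congr_fun hs x
  rw [← h3, ← map_smul, h2, map_zero]

end Covers

/-! ## Projective dimension -/

section ProjectiveDimension

variable {R : Type u} [Ring R]
variable {P M M' : Type u} [AddCommGroup P] [Module R P]
  [AddCommGroup M] [Module R M] [AddCommGroup M'] [Module R M']

/-- The projective dimension of a module that is not bundled is smaller than `n`. -/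
abbrev ProjDimLT (R : Type u) [Ring R] (M : Type u) [AddCommGroup M] [Module R M] (n : ℕ) : Prop :=
  HasProjectiveDimensionLT (ModuleCat.of R M) n

theorem ProjDimLT.congr {n : ℕ} (h : ProjDimLT R M n) (e : M ≃ₗ[R] M') : ProjDimLT R M' n :=
  hasProjectiveDimensionLT_of_iso e.toModuleIso n

theorem ProjDimLT.mono {m n : ℕ} (h : ProjDimLT R M m) (hmn : m ≤ n) : ProjDimLT R M n :=
  hasProjectiveDimensionLT_of_ge _ m n hmn

theorem ProjDimLT.retract {n : ℕ} (h : ProjDimLT R M n) (i : M' →ₗ[R] M) (r : M →ₗ[R] M')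
    (hr : ∀ x, r (i x) = x) : ProjDimLT R M' n :=
  Retract.hasProjectiveDimensionLT
    (X := ModuleCat.of R M') (Y := ModuleCat.of R M)
    { i := ModuleCat.ofHom i, r := ModuleCat.ofHom r, retract := by ext x; exact hr x } n

theorem ProjDimLT.zero_iff : ProjDimLT R M 0 ↔ Subsingleton M := by
  rw [ProjDimLT, hasProjectiveDimensionLT_zero_iff_isZero, ModuleCat.isZero_iff_subsingleton]

theorem ProjDimLT.one_iff : ProjDimLT R M 1 ↔ Module.Projective R M := by
  rw [ProjDimLT, ← projective_iff_hasProjectiveDimensionLT_one, IsProjective.iff_projective]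

theorem ProjDimLT.prod {n : ℕ} (h : ProjDimLT R M n) (h' : ProjDimLT R M' n) :
    ProjDimLT R (M × M') n := by
  have hs : (LinearMap.snd R M M').shortComplexKer.ShortExact :=
    LinearMap.shortExact_shortComplexKer LinearMap.snd_surjective
  refine hs.hasProjectiveDimensionLT_X₂ n ?_ h'
  refine ProjDimLT.congr (M' := LinearMap.ker (LinearMap.snd R M M')) h ?_
  exact LinearEquiv.ofBijective
    ((LinearMap.inl R M M').codRestrict _ fun x => rfl)
    ⟨fun x y h => congrArg (fun z => z.1.1) h, fun ⟨⟨x, y⟩, h⟩ => ⟨x, by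
      have h' : y = 0 := h
      subst h'; rfl⟩⟩

theorem ProjDimLT.iff_of_equiv_prod {N : Type u} [AddCommGroup N] [Module R N] {n : ℕ}
    (e : N ≃ₗ[R] M × M') : ProjDimLT R N n ↔ ProjDimLT R M n ∧ ProjDimLT R M' n :=
  ⟨fun h =>
    ⟨h.retract (e.symm.toLinearMap ∘ₗ LinearMap.inl R M M') (LinearMap.fst R M M' ∘ₗ e.toLinearMap)
        fun x => congrArg Prod.fst (e.apply_symm_apply (x, 0)),
      h.retract (e.symm.toLinearMap ∘ₗ LinearMap.inr R M M') (LinearMap.snd R M M' ∘ₗ e.toLinearMap)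
        fun x => congrArg Prod.snd (e.apply_symm_apply (0, x))⟩,
    fun h => (h.1.prod h.2).congr e.symm⟩

/-- For `n > 0` this is ordinary dimension shifting. For `n = 0` it says that `M` is projective
exactly when the kernel is zero, and this needs a projective cover: a section of `p` is onto by
superfluity. -/
theorem ProjCover.projDimLT_succ_iff {p : P →ₗ[R] M} (hp : ProjCover p) (n : ℕ) :
    ProjDimLT R M (n + 1) ↔ ProjDimLT R (LinearMap.ker p) n := by
  have hP : Module.Projective R P := hp.projective
  have hs : p.shortComplexKer.ShortExact := LinearMap.shortExact_shortComplexKer hp.surjective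
  cases n with
  | succ n =>
    exact hs.hasProjectiveDimensionLT_X₃_iff n ((IsProjective.iff_projective P).1 hP)
  | zero =>
    rw [ProjDimLT.zero_iff, ProjDimLT.one_iff]
    constructor
    · intro h
      obtain ⟨s, hs⟩ := Module.projective_lifting_property p LinearMap.id hp.surjective
      have hs' : ∀ x, p (s x) = x := LinearMap.congr_fun hs
      have h1 : LinearMap.range s = ⊤ := by
        refine hp.superfluous _ (eq_top_iff.2 fun x _ => Submodule.mem_sup.2
          ⟨s (p x), LinearMap.mem_range_self _ _, x - s (p x), ?_, add_sub_cancel _ _⟩)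
        exact LinearMap.mem_ker.2 ((map_sub p x _).trans (sub_eq_zero.2 (hs' (p x)).symm))
      refine ⟨fun x y => Subtype.ext ?_⟩
      obtain ⟨a, ha⟩ := LinearMap.range_eq_top.1 h1 x
      obtain ⟨b, hb⟩ := LinearMap.range_eq_top.1 h1 y
      have hx : p x = 0 := x.2
      have hy : p y = 0 := y.2
      rw [← ha, hs'] at hx
      rw [← hb, hs'] at hy
      rw [← ha, ← hb, hx, hy]
    · intro h
      have hinj : Function.Injective p := by
        rw [← LinearMap.ker_eq_bot, ← Submodule.subsingleton_iff_eq_bot]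
        exact h
      exact Module.Projective.of_equiv (LinearEquiv.ofBijective p ⟨hinj, hp.surjective⟩)

end ProjectiveDimension

/-! ## Simple modules over artinian rings -/

section Simple

variable {R : Type u} [Ring R]

theorem exists_linearEquiv_pi_simple (M : Type u) [AddCommGroup M] [Module R M]
    [Module.Finite R M] [IsSemisimpleModule R M] :
    ∃ (n : ℕ) (S : Fin n → Submodule R M),
      (∀ i, IsSimpleModule R (S i)) ∧ Nonempty (M ≃ₗ[R] ∀ i, S i) := by
  obtain ⟨n, S, e, hS⟩ := IsSemisimpleModule.exists_linearEquiv_fin_dfinsupp R M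
  exact ⟨n, S, hS, ⟨e.trans (DFinsupp.linearEquivFunOnFintype (R := R))⟩⟩

theorem isSemisimpleModule_quotient_jacobson [IsArtinianRing R] (M : Type u) [AddCommGroup M]
    [Module R M] [Module.Finite R M] : IsSemisimpleModule R (M ⧸ Module.jacobson R M) :=
  (IsArtinian.isSemisimpleModule_iff_jacobson R _).2 (Module.jacobson_quotient_jacobson R M)

/-- Every simple module is a quotient of the semisimple module `R / rad R`, so it is isomorphic to
one of the finitely many simple summands; one summand is kept from each isomorphism class. -/
theorem exists_simple_representatives (R : Type u) [Ring R] [IsArtinianRing R] :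
    ∃ (m : ℕ) (S : Fin m → ModuleCat.{u} R),
      (∀ i, IsSimpleModule R (S i)) ∧
      (∀ i j, Nonempty (S i ≃ₗ[R] S j) → i = j) ∧
      (∀ T : ModuleCat.{u} R, IsSimpleModule R T → ∃ i, Nonempty (T ≃ₗ[R] S i)) := by
  have := isSemisimpleModule_quotient_jacobson (R := R) R
  obtain ⟨n, S, hS, ⟨e⟩⟩ := exists_linearEquiv_pi_simple (R := R) (R ⧸ Module.jacobson R R)
  have hall : ∀ T : ModuleCat.{u} R, IsSimpleModule R T → ∃ i, Nonempty (T ≃ₗ[R] S i) := by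
    intro T hT
    obtain ⟨hn, hsurj⟩ := isSimpleModule_iff_toSpanSingleton_surjective.1 hT
    obtain ⟨t, ht⟩ := exists_ne (0 : T)
    let q := (Module.jacobson R R).liftQ (LinearMap.toSpanSingleton R T t)
      (IsSemisimpleModule.jacobson_le_ker R R R T _)
    by_contra! hno
    -- Schur's lemma: a nonzero map between simple modules is an isomorphism.
    have hz : ∀ i, q ∘ₗ e.symm.toLinearMap ∘ₗ LinearMap.single R (fun i => S i) i = 0 := by
      intro i
      by_contra h
      have := hS i
      obtain ⟨e'⟩ : Nonempty (S i ≃ₗ[R] T) :=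
        ⟨LinearEquiv.ofBijective _ (LinearMap.bijective_of_ne_zero h)⟩
      exact (hno i).elim e'.symm
    have hq : q ∘ₗ e.symm.toLinearMap = 0 := LinearMap.pi_ext' hz
    have h1 : q (Submodule.Quotient.mk 1) = 0 := by
      have := LinearMap.congr_fun hq (e (Submodule.Quotient.mk 1))
      simpa using this
    have h2 : q (Submodule.Quotient.mk 1) = t :=
      (Submodule.liftQ_apply _ _ _).trans (one_smul R t)
    exact ht (h2.symm.trans h1)
  let r : Setoid (Fin n) :=
    { r := fun i j => Nonempty (S i ≃ₗ[R] S j)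
      iseqv := ⟨fun i => ⟨LinearEquiv.refl R _⟩, fun ⟨e⟩ => ⟨e.symm⟩,
        fun ⟨e⟩ ⟨e'⟩ => ⟨e.trans e'⟩⟩ }
  let c := Finite.equivFin (Quotient r)
  refine ⟨_, fun j => ModuleCat.of R (S (c.symm j).out), fun j => hS _, fun i j h => ?_,
    fun T hT => ?_⟩
  · exact c.symm.injective (Quotient.out_equiv_out.1 h)
  · obtain ⟨i, ⟨e'⟩⟩ := hall T hT
    refine ⟨c (Quotient.mk r i), ?_⟩
    obtain ⟨e''⟩ : Nonempty (S (Quotient.mk r i).out ≃ₗ[R] S i) := Quotient.mk_out (s := r) i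
    change Nonempty (T ≃ₗ[R] S (c.symm (c (Quotient.mk r i))).out)
    rw [Equiv.symm_apply_apply]
    exact ⟨e'.trans e''.symm⟩

end Simple

/-! ## Detecting projective modules in `K₀` -/

namespace K0

section

variable {R : Type u} [Ring R] [IsArtinianRing R] [IsNoetherianRing R]

theorem length_ne_top (M : Type u) [AddCommGroup M] [Module R M] [Module.Finite R M] :
    Module.length R M ≠ ⊤ :=
  Module.length_ne_top_iff.2
    (isFiniteLength_iff_isNoetherian_isArtinian.2 ⟨inferInstance, inferInstance⟩)

/-- The length of the syzygy of a module. -/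
noncomputable def coverKerLength (M : FGModuleCat.{u} R) : ℕ :=
  have : Module.Finite R M.obj := M.property
  (Module.length R
    (LinearMap.ker (ProjCover.exists_cover (R := R) M.obj).choose_spec.choose_spec.choose)).toNat

theorem coverKerLength_eq {M P : Type u} [AddCommGroup M] [Module R M] [Module.Finite R M]
    [AddCommGroup P] [Module R P] {p : P →ₗ[R] M} (hp : ProjCover p) :
    coverKerLength (⟨ModuleCat.of R M, ‹_›⟩ : FGModuleCat.{u} R) =
      (Module.length R (LinearMap.ker p)).toNat := by
  obtain ⟨e⟩ := (ProjCover.exists_cover (R := R) M).choose_spec.choose_spec.choose_spec.ker_equiv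
    hp (LinearEquiv.refl R M)
  exact congrArg ENat.toNat e.length_eq

variable (R) in
/-- The homomorphism from `K₀` to the integers that maps a module to the length of its syzygy. -/
noncomputable def syzygyLength : K0 R →+ ℤ :=
  QuotientAddGroup.lift _ (FreeAbelianGroup.lift fun M => (coverKerLength M : ℤ)) (by
    rw [AddSubgroup.closure_le]
    rintro x hx
    change FreeAbelianGroup.lift _ x = 0
    cases hx with
    | sum M M' M'' h =>
      obtain ⟨e⟩ := h
      have : Module.Finite R M.obj := M.property
      have : Module.Finite R M'.obj := M'.property
      have : Module.Finite R M''.obj := M''.property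
      obtain ⟨n, P, p, hp⟩ := ProjCover.exists_cover (R := R) M'.obj
      obtain ⟨n', P', p', hp'⟩ := ProjCover.exists_cover (R := R) M''.obj
      have h0 : coverKerLength M = _ := coverKerLength_eq ((hp.prod hp').comp_equiv e.symm)
      have h1 : coverKerLength M' = _ := coverKerLength_eq hp
      have h2 : coverKerLength M'' = _ := coverKerLength_eq hp'
      have hk : LinearMap.ker (e.symm.toLinearMap ∘ₗ p.prodMap p') =
          (LinearMap.ker p).prod (LinearMap.ker p') := by
        rw [LinearEquiv.ker_comp, LinearMap.ker_prodMap]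
      have h3 := LinearEquiv.length_eq (R := R)
        (M := LinearMap.ker (e.symm.toLinearMap ∘ₗ p.prodMap p'))
        (N := LinearMap.ker p × LinearMap.ker p')
        ((LinearEquiv.ofEq _ _ hk).trans (prodKerEquiv p p'))
      rw [Module.length_prod] at h3
      rw [h3, ENat.toNat_add (length_ne_top _) (length_ne_top _), ← h1, ← h2] at h0
      simp only [map_sub, FreeAbelianGroup.lift_apply_of, h0]
      push_cast
      ring
    | proj P h =>
      have : Module.Finite R P.obj := P.property
      have hp : ProjCover (LinearMap.id : P.obj →ₗ[R] P.obj) :=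
        ⟨h, Function.surjective_id, fun N hN => by simpa using hN⟩
      have h0 : coverKerLength P = _ := coverKerLength_eq hp
      have : Subsingleton (LinearMap.ker (LinearMap.id : P.obj →ₗ[R] P.obj)) := by
        rw [LinearMap.ker_id]; infer_instance
      rw [FreeAbelianGroup.lift_apply_of, h0, Module.length_eq_zero_iff.2 this]
      rfl)

/-- The length of the syzygy is additive and vanishes on projectives, so it is an invariant of the
class. If it is zero, the projective cover is an isomorphism. This avoids unique decomposition into
indecomposables. -/
theorem projective_of_cls_eq_zero {M : Type u} [AddCommGroup M] [Module R M] [Module.Finite R M]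
    (h : cls R M = 0) : Module.Projective R M := by
  obtain ⟨n, P, p, hp⟩ := ProjCover.exists_cover (R := R) M
  have h1 : syzygyLength R (cls R M) = _ := FreeAbelianGroup.lift_apply_of _ _
  rw [h, map_zero, coverKerLength_eq hp] at h1
  have h2 : Module.length R (LinearMap.ker p) = 0 := by
    have h3 := Int.natCast_eq_zero.1 h1.symm
    rw [ENat.toNat_eq_zero] at h3
    exact h3.resolve_right (length_ne_top _)
  exact ProjDimLT.one_iff.1 ((hp.projDimLT_succ_iff 0).2
    (ProjDimLT.zero_iff.2 (Module.length_eq_zero_iff.1 h2)))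

/-- The witness is the `j`-th syzygy, recorded only through its class and its projective dimension.
-/
theorem exists_omegaBar_pow_eq (j : ℕ) (M : Type u) [AddCommGroup M] [Module R M]
    [Module.Finite R M] : ∃ (N : ModuleCat.{u} R) (_ : Module.Finite R N),
      (omegaBar R ^ j) (cls R M) = cls R N ∧
        ∀ n, ProjDimLT R M (n + j) ↔ ProjDimLT R N n := by
  induction j with
  | zero => exact ⟨ModuleCat.of R M, ‹_›, rfl, fun n => Iff.rfl⟩
  | succ j ih =>
    obtain ⟨N, hN, h1, h2⟩ := ih
    obtain ⟨n, P, p, hp⟩ := ProjCover.exists_cover (R := R) N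
    refine ⟨ModuleCat.of R (LinearMap.ker p), inferInstanceAs (Module.Finite R (LinearMap.ker p)),
      ?_, fun n => ?_⟩
    · rw [pow_succ']
      refine (congrArg (omegaBar R) h1).trans ?_
      exact omegaBar_mk (⟨ModuleCat.of R N, hN⟩ : FGModuleCat.{u} R)
        (⟨ModuleCat.of R (LinearMap.ker p), inferInstanceAs (Module.Finite R (LinearMap.ker p))⟩ :
          FGModuleCat.{u} R) ⟨_, _, hp, ⟨LinearEquiv.refl R _⟩⟩
    · rw [← add_assoc, add_right_comm, h2, hp.projDimLT_succ_iff]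

/-- The projective dimensions of the modules of finite projective dimension with class in a syzygy
finite subgroup are bounded. -/
theorem SyzygyFinite.exists_bound {G : AddSubgroup (K0 R)} (hG : SyzygyFinite G) :
    ∃ F : ℕ, ∀ (M : Type u) [AddCommGroup M] [Module R M] [Module.Finite R M] (d : ℕ),
      cls R M ∈ G → ProjDimLT R M d → ProjDimLT R M (F + 1) := by
  obtain ⟨n, hn⟩ := hG
  let H := AddSubgroup.toIntSubmodule (G.map (omegaBar R ^ n))
  have hfg : H.FG := (Submodule.fg_iff_addSubgroup_fg H).2 hn
  have : IsNoetherian ℤ H := isNoetherian_of_fg_of_noetherian H hfg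
  -- The increasing chain of the kernels of `Ω̄ ^ j` on the noetherian group `H = Ω̄ ^ n (G)`; it is
  -- constant from some `N` on.
  let κ : ℕ →o Submodule ℤ H :=
    { toFun := fun j => LinearMap.ker
        (AddMonoidHom.toIntLinearMap (omegaBar R ^ j : AddMonoid.End (K0 R)) ∘ₗ H.subtype)
      monotone' := monotone_nat_of_le_succ fun j x hx => by
        have hx' : (omegaBar R ^ j) x.1 = 0 := hx
        change (omegaBar R ^ (j + 1)) x.1 = 0
        rw [pow_succ']
        exact (congrArg (omegaBar R) hx').trans (map_zero _) }
  obtain ⟨N, hN⟩ := monotone_stabilizes_iff_noetherian.2 this κ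
  refine ⟨N + n, fun M _ _ _ d hM hd => ?_⟩
  let x : H := ⟨(omegaBar R ^ n) (cls R M), cls R M, hM, rfl⟩
  -- Finite projective dimension makes a high syzygy zero, so the class dies eventually; stability
  -- of the chain then forces it to die after `N` steps, independently of `d`.
  have hx : x ∈ κ (max N d) := by
    change (omegaBar R ^ (max N d)) ((omegaBar R ^ n) (cls R M)) = 0
    change (omegaBar R ^ (max N d) * omegaBar R ^ n) (cls R M) = 0
    rw [← pow_add]
    obtain ⟨L, hL, h1, h2⟩ := exists_omegaBar_pow_eq (R := R) (max N d + n) M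
    have h3 : ProjDimLT R L 0 := (h2 0).1 (hd.mono (by omega))
    have := ProjDimLT.one_iff.1 (h3.mono zero_le_one)
    rw [h1]
    exact cls_proj L
  rw [← hN _ (le_max_left N d)] at hx
  have hx' : (omegaBar R ^ N * omegaBar R ^ n) (cls R M) = 0 := hx
  rw [← pow_add] at hx'
  -- The syzygy of order `N + n` now has class zero, so it is projective and the projective
  -- dimension is at most `N + n`.
  obtain ⟨L, hL, h1, h2⟩ := exists_omegaBar_pow_eq (R := R) (N + n) M
  rw [h1] at hx'
  rw [add_comm, h2]
  exact ProjDimLT.one_iff.2 (projective_of_cls_eq_zero (R := R) hx')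

end

end K0

/-! ## Functoriality of the restriction to an idempotent part -/

section CornerFunctor

variable {R S : Type u} [Ring R] [Ring S] (f : R →ₙ+* S)
variable {M N : Type u} [AddCommGroup M] [Module S M] [AddCommGroup N] [Module S N]

/-- The part `f(1) M` of a module that is not bundled. -/
abbrev CornerOf (M : Type u) [AddCommGroup M] [Module S M] : Type u :=
  corner f (ModuleCat.of S M)

instance : Module R (CornerOf f M) :=
  (restrictTo f (ModuleCat.of S M)).isModule

namespace CornerOf

theorem map_one_mul_map_one : f 1 * f 1 = f 1 := by rw [← map_mul, one_mul]

theorem smul_mem (x : M) : f 1 • x ∈ corner f (ModuleCat.of S M) := by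
  change f 1 • f 1 • x = f 1 • x
  rw [smul_smul, map_one_mul_map_one]

/-- The map on the parts induced by a linear map. -/
def map (φ : M →ₗ[S] N) : CornerOf f M →ₗ[R] CornerOf f N where
  toFun x := ⟨φ x.1, by
    have hx : f 1 • x.1 = x.1 := x.2
    change f 1 • φ x.1 = φ x.1
    rw [← map_smul, hx]⟩
  map_add' x y := Subtype.ext (map_add φ x.1 y.1)
  map_smul' r x := Subtype.ext (map_smul φ (f r) x.1)

/-- Isomorphic modules have isomorphic parts. -/
def congr (e : M ≃ₗ[S] N) : CornerOf f M ≃ₗ[R] CornerOf f N :=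
  LinearEquiv.ofLinearMap (map f e.toLinearMap) (map f e.symm.toLinearMap)
    (LinearMap.ext fun x => Subtype.ext (e.apply_symm_apply x.1))
    (LinearMap.ext fun x => Subtype.ext (e.symm_apply_apply x.1))

/-- The part of a product is the product of the parts. -/
def piEquiv {ι : Type} (M : ι → Type u) [∀ i, AddCommGroup (M i)] [∀ i, Module S (M i)] :
    CornerOf f (∀ i, M i) ≃ₗ[R] ∀ i, CornerOf f (M i) where
  toFun x i := ⟨x.1 i, congrFun x.2 i⟩
  map_add' _ _ := rfl
  map_smul' _ _ := rfl
  invFun y := ⟨fun i => (y i).1, funext fun i => (y i).2⟩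

/-- The part of a submodule that contains the part of the whole module. -/
noncomputable def submoduleEquiv (K : Submodule S M)
    (hK : ∀ x : M, f 1 • x = x → x ∈ K) : CornerOf f K ≃ₗ[R] CornerOf f M :=
  LinearEquiv.ofBijective (map f K.subtype)
    ⟨fun _ _ h => Subtype.ext (Subtype.ext (congrArg (fun z : CornerOf f M => z.1) h)),
      fun x => ⟨⟨⟨x.1, hK x.1 x.2⟩, Subtype.ext x.2⟩, rfl⟩⟩

/-- The part of a kernel is the kernel of the induced map. -/
noncomputable def kerEquiv (φ : M →ₗ[S] N) :
    CornerOf f (LinearMap.ker φ) ≃ₗ[R] LinearMap.ker (map f φ) :=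
  LinearEquiv.ofBijective
    ((map f (LinearMap.ker φ).subtype).codRestrict _ fun x =>
      LinearMap.mem_ker.2 (Subtype.ext (LinearMap.mem_ker.1 x.1.2)))
    ⟨fun _ _ h => Subtype.ext (Subtype.ext (congrArg (fun z => z.1.1) h)),
      fun x => ⟨⟨⟨x.1.1, congrArg Subtype.val x.2⟩,
        Subtype.ext (show f 1 • x.1.1 = x.1.1 from x.1.2)⟩, rfl⟩⟩

end CornerOf

/-- A module over `R`, viewed as a module over `S` through `ρ : S → R`. -/
def Inflate {R S : Type u} [Ring R] [Ring S] (_ : S →+* R) (N : Type u) : Type u := N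

instance (ρ : S →+* R) (N : Type u) [AddCommGroup N] : AddCommGroup (Inflate ρ N) :=
  inferInstanceAs (AddCommGroup N)

instance (ρ : S →+* R) (N : Type u) [AddCommGroup N] [Module R N] : Module S (Inflate ρ N) :=
  Module.compHom N ρ

namespace Inflate

variable {ρ : S →+* R} {X Y : Type u} [AddCommGroup X] [Module R X] [AddCommGroup Y] [Module R Y]

/-- Inflation of linear maps. -/
def map (ρ : S →+* R) (φ : X →ₗ[R] Y) : Inflate ρ X →ₗ[S] Inflate ρ Y where
  toFun := φ
  map_add' := map_add φ
  map_smul' s x := φ.map_smul (ρ s) (show X from x)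

/-- Inflation of isomorphisms. -/
def congr (ρ : S →+* R) (e : X ≃ₗ[R] Y) : Inflate ρ X ≃ₗ[S] Inflate ρ Y :=
  LinearEquiv.ofLinearMap (map ρ e.toLinearMap) (map ρ e.symm.toLinearMap)
    (LinearMap.ext e.apply_symm_apply) (LinearMap.ext e.symm_apply_apply)

theorem finite (hρ : Function.Surjective ρ) [Module.Finite R X] :
    Module.Finite S (Inflate ρ X) := by
  obtain ⟨s, hs⟩ := Module.Finite.fg_top (R := R) (M := X)
  refine ⟨⟨s, eq_top_iff.2 fun (x : X) _ => ?_⟩⟩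
  have hx : x ∈ Submodule.span R (s : Set X) := hs ▸ Submodule.mem_top
  change x ∈ (Submodule.span S (M := Inflate ρ X) (s : Set X))
  induction hx using Submodule.span_induction with
  | mem x h => exact Submodule.subset_span h
  | zero => exact Submodule.zero_mem _
  | add x y _ _ hx hy => exact Submodule.add_mem _ (hx trivial) (hy trivial)
  | smul r x _ hx =>
    obtain ⟨t, rfl⟩ := hρ r
    exact Submodule.smul_mem _ t (hx trivial)

end Inflate

end CornerFunctor

theorem isDirectSummand_of_retract {R : Type u} [Ring R] {L N : Type u} [AddCommGroup L]
    [Module R L] [AddCommGroup N] [Module R N] (i : L →ₗ[R] N) (r : N →ₗ[R] L)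
    (h : ∀ x, r (i x) = x) : IsDirectSummand (ModuleCat.of R L) (ModuleCat.of R N) :=
  ⟨ModuleCat.of R (LinearMap.ker r),
    ⟨{ toFun := fun x => (r x, ⟨x - i (r x), by simp [h]⟩)
       map_add' := fun x y => Prod.ext (map_add r x y) (Subtype.ext (by
         change x + y - i (r (x + y)) = (x - i (r x)) + (y - i (r y))
         rw [map_add, map_add]; abel))
       map_smul' := fun c x => Prod.ext (map_smul r c x) (Subtype.ext (by
         change c • x - i (r (c • x)) = c • (x - i (r x))
         rw [map_smul, map_smul, smul_sub]))
       invFun := fun y => i y.1 + y.2.1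
       left_inv := fun x => add_sub_cancel _ _
       right_inv := fun ⟨y, z⟩ => by
         have hz : r z.1 = 0 := z.2
         refine Prod.ext ?_ (Subtype.ext ?_)
         · change r (i y + z.1) = y
           rw [map_add, h, hz, add_zero]
         · change i y + z.1 - i (r (i y + z.1)) = z.1
           rw [map_add, h, hz, add_zero, add_sub_cancel_left] }⟩⟩

/-! ## Two complementary corners that annihilate the mixed part of the radical -/

section Square

variable {R S T : Type u} [Ring R] [Ring S] [Ring T]

/-- The rings `R` and `T` are the diagonal corners of `S`, the corresponding projections `S → R`
and `S → T` are ring homomorphisms, and the off-diagonal parts annihilate the radical. -/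
structure IsDiagonalPair (f : R →ₙ+* S) (g : T →ₙ+* S) : Prop where
  add_one : f 1 + g 1 = 1
  exists_left : ∃ ρ : S →+* R, (∀ r, ρ (f r) = r) ∧ ∀ s, f (ρ s) = f 1 * s * f 1
  exists_right : ∃ ρ : S →+* T, (∀ t, ρ (g t) = t) ∧ ∀ s, g (ρ s) = g 1 * s * g 1
  left_radical : ∀ s, ∀ x ∈ Ring.jacobson S, g 1 * s * f 1 * x = 0
  right_radical : ∀ s, ∀ x ∈ Ring.jacobson S, f 1 * s * g 1 * x = 0

variable {f : R →ₙ+* S} {g : T →ₙ+* S}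

theorem IsDiagonalPair.symm (h : IsDiagonalPair f g) : IsDiagonalPair g f :=
  ⟨(add_comm _ _).trans h.add_one, h.exists_right, h.exists_left, h.right_radical, h.left_radical⟩

theorem orbitSubgroup_comm : orbitSubgroup f g = orbitSubgroup g f :=
  congrArg AddSubgroup.closure (Set.union_comm _ _)

namespace IsDiagonalPair

theorem one_mul_one (h : IsDiagonalPair f g) : f 1 * g 1 = 0 := by
  have h1 := congrArg (f 1 * ·) h.add_one
  simpa [mul_add, CornerOf.map_one_mul_map_one] using h1

theorem smul_add_smul (h : IsDiagonalPair f g) {M : Type u} [AddCommGroup M] [Module S M] (x : M) :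
    f 1 • x + g 1 • x = x := by
  rw [← add_smul, h.add_one, one_smul]

theorem smul_smul_eq_zero (h : IsDiagonalPair f g) {M : Type u} [AddCommGroup M] [Module S M] (x : M) :
    f 1 • g 1 • x = 0 := by
  rw [smul_smul, h.one_mul_one, zero_smul]

/-- The part `f(1) M` as a submodule, if the off-diagonal part `g(1) S f(1)` annihilates `M`. -/
def part (h : IsDiagonalPair f g) {M : Type u} [AddCommGroup M] [Module S M]
    (hM : ∀ s (x : M), (g 1 * s * f 1) • x = 0) : Submodule S M where
  carrier := {x | f 1 • x = x}
  zero_mem' := smul_zero _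
  add_mem' {a b} ha hb := by
    have ha' : f 1 • a = a := ha
    have hb' : f 1 • b = b := hb
    change f 1 • (a + b) = a + b
    rw [smul_add, ha', hb']
  smul_mem' s x hx := by
    have hx' : f 1 • x = x := hx
    change f 1 • s • x = s • x
    -- As `x = f 1 • x`, the component `g 1 • s • x` is the action of an off-diagonal element on
    -- `x`.
    have h1 := hM s x
    rw [mul_smul, mul_smul, hx'] at h1
    have h2 := h.smul_add_smul (s • x)
    rwa [h1, add_zero] at h2

section

variable (h : IsDiagonalPair f g) {M : Type u} [AddCommGroup M] [Module S M]
  (hM : ∀ s (x : M), (g 1 * s * f 1) • x = 0) (hM' : ∀ s (x : M), (f 1 * s * g 1) • x = 0)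

theorem smul_part (x : h.part hM) : f 1 • x = x := Subtype.ext x.2

/-- The part `f(1) M` as a submodule has the same restriction as `M`. -/
noncomputable def cornerPartEquiv : CornerOf f (h.part hM) ≃ₗ[R] CornerOf f M :=
  CornerOf.submoduleEquiv f _ fun _ hx => hx

include hM' in
/-- A module annihilated by the off-diagonal parts is the direct sum of its two parts. -/
theorem exists_equiv_parts : Nonempty (M ≃ₗ[S] h.part hM × h.symm.part hM') := by
  refine ⟨LinearEquiv.symm (LinearEquiv.ofBijective
    ((h.part hM).subtype.coprod (h.symm.part hM').subtype) ⟨?_, fun x => ?_⟩)⟩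
  · refine (injective_iff_map_eq_zero _).2 ?_
    rintro ⟨⟨x, hx⟩, ⟨y, hy⟩⟩ hxy
    have hx' : f 1 • x = x := hx
    have hy' : g 1 • y = y := hy
    have hxy' : x + y = 0 := hxy
    have h1 : f 1 • (x + y) = 0 := by rw [hxy', smul_zero]
    rw [smul_add, hx', ← hy', h.smul_smul_eq_zero, add_zero] at h1
    rw [h1, zero_add] at hxy'
    exact Prod.ext (Subtype.ext h1) (Subtype.ext hxy')
  · exact ⟨(⟨f 1 • x, CornerOf.smul_mem f x⟩, ⟨g 1 • x, CornerOf.smul_mem g x⟩),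
      h.smul_add_smul x⟩

end

section Cover

variable (h : IsDiagonalPair f g) {M P : Type u} [AddCommGroup M] [Module S M] [Module.Finite S M]
  [AddCommGroup P] [Module S P] {p : P →ₗ[S] M} (hp : ProjCover p)

include h hp

theorem smul_ker_left (s : S) (x : LinearMap.ker p) : (g 1 * s * f 1) • x = 0 :=
  have := hp.finite
  Subtype.ext (hp.smul_eq_zero_of_mem_ker (h.left_radical s) x.2)

theorem smul_ker_right (s : S) (x : LinearMap.ker p) : (f 1 * s * g 1) • x = 0 :=
  have := hp.finite
  Subtype.ext (hp.smul_eq_zero_of_mem_ker (h.right_radical s) x.2)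

-- The element `g 1` acts as zero on `M`, so the whole part `g(1) P` of the cover belongs to the
-- syzygy.
omit [Module.Finite S M] hp in
theorem smul_mem_ker (hM : ∀ m : M, f 1 • m = m) (x : P) : g 1 • x ∈ LinearMap.ker p := by
  rw [LinearMap.mem_ker, map_smul, ← hM (p x), h.symm.smul_smul_eq_zero]

/-- Since `g 1 • x` already lies in the kernel of the cover, the off-diagonal part kills it.
Consequently `x ↦ f 1 • x` is `S`-linear when `S` acts on the part through `ρ`. -/
theorem smul_cover (hM : ∀ m : M, f 1 • m = m) (s : S) (x : P) : (f 1 * s * g 1) • x = 0 := by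
  have h1 := congrArg Subtype.val
    (h.smul_ker_right hp s ⟨g 1 • x, h.smul_mem_ker hM x⟩)
  have h2 : (f 1 * s * g 1) • g 1 • x = 0 := h1
  rwa [smul_smul, mul_assoc, CornerOf.map_one_mul_map_one] at h2

/-- A surjection onto `f(1) P` over `R` is inflated to `S`; the projection `θ` of `P` onto its part
is lifted through it by projectivity of `P`, and the lift is restricted to the part. -/
theorem projective_corner (hM : ∀ m : M, f 1 • m = m) : Module.Projective R (CornerOf f P) := by
  obtain ⟨ρ, hρ, hρ'⟩ := h.exists_left
  have : Module.Projective S P := hp.projective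
  refine Module.Projective.of_lifting_property'' fun q hq => ?_
  let θ : P →ₗ[S] Inflate ρ (CornerOf f P) :=
    { toFun := fun x => (⟨f 1 • x, CornerOf.smul_mem f x⟩ : CornerOf f P)
      map_add' := fun x y => Subtype.ext (smul_add (f 1) x y)
      map_smul' := fun s x => Subtype.ext (by
        change f 1 • s • x = f (ρ s) • f 1 • x
        have h1 := h.smul_add_smul x
        have h2 := h.smul_cover hp hM s x
        rw [mul_smul, mul_smul] at h2
        conv_lhs => rw [← h1]
        rw [smul_add, smul_add, h2, add_zero, hρ', mul_smul, mul_smul, smul_smul (f 1) (f 1),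
          CornerOf.map_one_mul_map_one]) }
  obtain ⟨φ, hφ⟩ := Module.projective_lifting_property (Inflate.map ρ q) θ hq
  refine ⟨{ toFun := fun c => φ c.1
            map_add' := fun c d => map_add φ c.1 d.1
            map_smul' := fun r c => ?_ }, LinearMap.ext fun c => ?_⟩
  · exact (map_smul φ (f r) c.1).trans
      (congrArg (fun t => t • (show CornerOf f P →₀ R from φ c.1)) (hρ r))
  · exact (LinearMap.congr_fun hφ c.1).trans (Subtype.ext c.2)

theorem projCover_corner (hM : ∀ m : M, f 1 • m = m) : ProjCover (CornerOf.map f p) := by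
  refine ⟨h.projective_corner hp hM, fun m => ?_, fun N hN => ?_⟩
  · obtain ⟨x, hx⟩ := hp.surjective m.1
    have hx' : p x = m.1 := hx
    refine ⟨⟨f 1 • x, CornerOf.smul_mem f x⟩, Subtype.ext ?_⟩
    change p (f 1 • x) = m.1
    rw [map_smul, hx', hM]
  · obtain ⟨ρ, hρ, hρ'⟩ := h.exists_left
    -- The preimage of `N` under `x ↦ f 1 • x`. It is an `S`-submodule by `smul_cover`, so
    -- superfluity of the kernel of `p` can be applied to it.
    let N' : Submodule S P :=
      { carrier := {x | (⟨f 1 • x, CornerOf.smul_mem f x⟩ : CornerOf f P) ∈ N}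
        zero_mem' := by
          have h1 : (⟨f 1 • (0 : P), CornerOf.smul_mem f 0⟩ : CornerOf f P) = 0 :=
            Subtype.ext (smul_zero _)
          exact (congrArg (· ∈ N) h1).mpr N.zero_mem
        add_mem' := fun {x y} hx hy => by
          have h1 : (⟨f 1 • (x + y), CornerOf.smul_mem f (x + y)⟩ : CornerOf f P) =
              ⟨f 1 • x, CornerOf.smul_mem f x⟩ + ⟨f 1 • y, CornerOf.smul_mem f y⟩ :=
            Subtype.ext (smul_add _ _ _)
          exact (congrArg (· ∈ N) h1).mpr (N.add_mem hx hy)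
        smul_mem' := fun s x hx => by
          have h1 : (⟨f 1 • s • x, CornerOf.smul_mem f (s • x)⟩ : CornerOf f P) =
              ρ s • ⟨f 1 • x, CornerOf.smul_mem f x⟩ := Subtype.ext (by
            change f 1 • s • x = f (ρ s) • f 1 • x
            have h1 := h.smul_add_smul x
            have h2 := h.smul_cover hp hM s x
            rw [mul_smul, mul_smul] at h2
            conv_lhs => rw [← h1]
            rw [smul_add, smul_add, h2, add_zero, hρ', mul_smul, mul_smul, smul_smul (f 1) (f 1),
              CornerOf.map_one_mul_map_one])
          exact (congrArg (· ∈ N) h1).mpr (N.smul_mem _ hx) }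
    have h1 : N' = ⊤ := by
      refine hp.superfluous N' (eq_top_iff.2 fun x _ => ?_)
      let c : CornerOf f P := ⟨f 1 • x, CornerOf.smul_mem f x⟩
      obtain ⟨n, hn, k, hk, hnk⟩ := Submodule.mem_sup.1 (hN ▸ Submodule.mem_top : c ∈ _)
      have hn' : n.1 ∈ N' := by
        have h2 : (⟨f 1 • n.1, CornerOf.smul_mem f n.1⟩ : CornerOf f P) = n := Subtype.ext n.2
        exact (congrArg (· ∈ N) h2).mpr hn
      -- The term `g 1 • x` completes `f 1 • x` to `x` and lies in the kernel anyway.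
      refine Submodule.mem_sup.2 ⟨n.1, hn', k.1 + g 1 • x, ?_, ?_⟩
      · exact Submodule.add_mem _ (LinearMap.mem_ker.2 (congrArg Subtype.val hk))
          (h.smul_mem_ker hM x)
      · have h2 : n.1 + k.1 = f 1 • x := congrArg Subtype.val hnk
        rw [← add_assoc, h2]
        exact h.smul_add_smul x
    refine eq_top_iff.2 fun c _ => ?_
    have h2 : c.1 ∈ N' := h1 ▸ Submodule.mem_top
    have h3 : (⟨f 1 • c.1, CornerOf.smul_mem f c.1⟩ : CornerOf f P) = c := Subtype.ext c.2
    exact (congrArg (· ∈ N) h3).mp h2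

omit [Module.Finite S M] hp in
/-- The restriction of the syzygy of a module that lives on `R` to the opposite part is that of its
projective cover. -/
theorem exists_equiv_opposite (p : P →ₗ[S] M) (hM : ∀ m : M, f 1 • m = m) :
    Nonempty (CornerOf g (LinearMap.ker p) ≃ₗ[T] CornerOf g P) :=
  ⟨CornerOf.submoduleEquiv g _ fun x hx => hx ▸ h.smul_mem_ker hM x⟩

/-- The syzygy of a module is the direct sum of its two parts. -/
theorem exists_ker_parts [IsNoetherianRing S] : ∃ A B : ModuleCat.{u} S,
    Module.Finite S A ∧ Module.Finite S B ∧
    (∀ x : A, f 1 • x = x) ∧ (∀ x : B, g 1 • x = x) ∧ Nonempty (LinearMap.ker p ≃ₗ[S] A × B) ∧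
    Nonempty (CornerOf f A ≃ₗ[R] CornerOf f (LinearMap.ker p)) ∧
    Nonempty (CornerOf g B ≃ₗ[T] CornerOf g (LinearMap.ker p)) := by
  have := hp.finite
  obtain ⟨e⟩ := h.exists_equiv_parts (h.smul_ker_left hp) (h.smul_ker_right hp)
  exact ⟨ModuleCat.of S (h.part (h.smul_ker_left hp)),
    ModuleCat.of S (h.symm.part (h.smul_ker_right hp)),
    Module.Finite.of_surjective (LinearMap.fst S _ _ ∘ₗ e.toLinearMap)
      (Prod.fst_surjective.comp e.surjective),
    Module.Finite.of_surjective (LinearMap.snd S _ _ ∘ₗ e.toLinearMap)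
      (Prod.snd_surjective.comp e.surjective), h.smul_part _,
    h.symm.smul_part _, ⟨e⟩, ⟨h.cornerPartEquiv _⟩, ⟨h.symm.cornerPartEquiv _⟩⟩

end Cover

/-- On such a module `s` acts as `f (ρ s)`, so generators over `S` are generators over `R`. -/
theorem finite_corner (h : IsDiagonalPair f g) {M : Type u} [AddCommGroup M] [Module S M]
    [Module.Finite S M] (hM : ∀ m : M, f 1 • m = m) : Module.Finite R (CornerOf f M) := by
  obtain ⟨ρ, hρ, hρ'⟩ := h.exists_left
  obtain ⟨s, hs⟩ := Module.Finite.fg_top (R := S) (M := M)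
  let c : M → CornerOf f M := fun m => ⟨m, hM m⟩
  refine ⟨(Submodule.fg_def).2 ⟨c '' s, s.finite_toSet.image c, eq_top_iff.2 fun x _ => ?_⟩⟩
  have key : ∀ m : M, c m ∈ Submodule.span R (c '' s) := by
    intro m
    have hm : m ∈ Submodule.span S (s : Set M) := hs ▸ Submodule.mem_top
    induction hm using Submodule.span_induction with
    | mem x h => exact Submodule.subset_span ⟨x, h, rfl⟩
    | zero => exact Submodule.zero_mem _
    | add x y _ _ hx hy => exact Submodule.add_mem _ hx hy
    | smul t x _ hx =>
      have h1 : c (t • x) = ρ t • c x := Subtype.ext (by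
        change t • x = f (ρ t) • x
        rw [hρ', mul_smul, mul_smul, hM x, hM])
      exact h1 ▸ Submodule.smul_mem _ _ hx
  exact key x.1

variable [IsArtinianRing S] [IsNoetherianRing S]

/-- The syzygy over `R` is the `R`-part of the syzygy over `S`, hence a direct summand of it, so the
induction never leaves the modules that live on `R`. -/
theorem projDimLT_corner (h : IsDiagonalPair f g) (n : ℕ) : ∀ (M : Type u) [AddCommGroup M]
    [Module S M] [Module.Finite S M], (∀ m : M, f 1 • m = m) → ProjDimLT S M n →
    ProjDimLT R (CornerOf f M) n := by
  induction n with
  | zero =>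
    intro M _ _ _ _ hn
    have := ProjDimLT.zero_iff.1 hn
    exact ProjDimLT.zero_iff.2 ⟨fun x y => Subtype.ext (this.elim _ _)⟩
  | succ n ih =>
    intro M _ _ _ hM hn
    obtain ⟨m, P, p, hp⟩ := ProjCover.exists_cover (R := S) M
    obtain ⟨A, B, _, _, hA, -, ⟨e⟩, ⟨e'⟩, -⟩ := h.exists_ker_parts hp
    have h2 : ProjDimLT S A n :=
      ((ProjDimLT.iff_of_equiv_prod e).1 ((hp.projDimLT_succ_iff n).1 hn)).1
    exact ((h.projCover_corner hp hM).projDimLT_succ_iff n).2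
      ((ih A hA h2).congr (e'.trans (CornerOf.kerEquiv f p)))

end IsDiagonalPair

end Square

/-! ### Inflated modules, membership in the orbit subgroup, and the dimension bound -/

namespace IsDiagonalPair

variable {R S T : Type u} [Ring R] [Ring S] [Ring T] {f : R →ₙ+* S} {g : T →ₙ+* S}

section Inflation

variable {ρ : S →+* R} (hρ : ∀ r, ρ (f r) = r) (hρ' : ∀ s, f (ρ s) = f 1 * s * f 1)

include hρ in
theorem smul_inflate {X : Type u} [AddCommGroup X] [Module R X] (x : Inflate ρ X) :
    f 1 • x = x := by
  change ρ (f 1) • (show X from x) = (show X from x)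
  rw [hρ, one_smul]

/-- The part of a product of inflated modules. -/
def cornerPiInflateEquiv {ι : Type} (X : ι → Type u)
    [∀ i, AddCommGroup (X i)] [∀ i, Module R (X i)] :
    CornerOf f (∀ i, Inflate ρ (X i)) ≃ₗ[R] ∀ i, X i where
  toFun x i := x.1 i
  map_add' _ _ := rfl
  map_smul' r x := funext fun i =>
    congrArg (fun t => t • (show X i from x.1 i)) (hρ r)
  invFun y := ⟨y, funext fun i => smul_inflate hρ (X := X i) (y i)⟩

include hρ' in
/-- A module that lives on the part of `R` is inflated. -/
def equivInflateCorner {M : Type u} [AddCommGroup M] [Module S M] (hM : ∀ m : M, f 1 • m = m) :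
    M ≃ₗ[S] Inflate ρ (CornerOf f M) where
  toFun m := (⟨m, hM m⟩ : CornerOf f M)
  map_add' _ _ := rfl
  map_smul' s m := Subtype.ext (by
    change s • m = f (ρ s) • m
    rw [hρ', mul_smul, mul_smul, hM m, hM])
  invFun c := (show CornerOf f M from c).1

include hρ' in
theorem isSimpleModule_corner {M : Type u} [AddCommGroup M] [Module S M] [IsSimpleModule S M]
    (hM : ∀ m : M, f 1 • m = m) : IsSimpleModule R (CornerOf f M) := by
  obtain ⟨hn, hs⟩ := isSimpleModule_iff_toSpanSingleton_surjective.1 ‹IsSimpleModule S M›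
  refine isSimpleModule_iff_toSpanSingleton_surjective.2 ⟨?_, fun x hx y => ?_⟩
  · obtain ⟨m, hm⟩ := exists_ne (0 : M)
    exact ⟨⟨⟨m, hM m⟩, 0, fun h => hm (congrArg Subtype.val h)⟩⟩
  · obtain ⟨s, hs⟩ := hs x.1 (fun h => hx (Subtype.ext h)) y.1
    have hs' : s • x.1 = y.1 := hs
    refine ⟨ρ s, Subtype.ext ?_⟩
    change f (ρ s) • x.1 = y.1
    rw [hρ', mul_smul, mul_smul, hM x.1, hs', hM]

end Inflation

variable [IsArtinianRing R] [IsArtinianRing S] [IsNoetherianRing S]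

/-- The cover of `M` is also the cover of its top, a finite sum of simple modules inflated from `R`,
so `P` is a sum of covers `Q i` of the inflated simples. Each `g(1) Q i` is a summand of the
`T`-part of the syzygy of the sum of all simples. -/
theorem corner_cover_mem_addClosure (h : IsDiagonalPair f g) {M P : Type u} [AddCommGroup M]
    [Module S M] [Module.Finite S M] [AddCommGroup P] [Module S P] {p : P →ₗ[S] M}
    (hp : ProjCover p) (hM : ∀ m : M, f 1 • m = m) :
    ModuleCat.of T (CornerOf g P) ∈ addClosure (mixedOrbit g f) := by
  obtain ⟨ρ, hρ, hρ'⟩ := h.exists_left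
  have hsurj : Function.Surjective ρ := fun r => ⟨f r, hρ r⟩
  obtain ⟨m, E, hE, hinj, hall⟩ := exists_simple_representatives R
  have hEfin : ∀ i, Module.Finite S (Inflate ρ (E i)) := fun i =>
    have := hE i
    Inflate.finite hsurj
  choose n Q q hq using fun i => ProjCover.exists_cover (R := S) (Inflate ρ (E i))
  have hcov := ProjCover.pi hq
  have hfix : ∀ x : (∀ i, Inflate ρ (E i)), f 1 • x = x := fun x =>
    funext fun i => smul_inflate hρ (X := E i) (x i)
  -- The `T`-part of this syzygy is the whole `T`-part of the cover, so it decomposes along the `Q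
  -- i`.
  obtain ⟨e₁⟩ := h.exists_equiv_opposite (LinearMap.piMap q) hfix
  have e₂ := e₁.trans (CornerOf.piEquiv g fun i => Q i)
  have hmem : restrictTo g (ModuleCat.of S (LinearMap.ker (LinearMap.piMap q))) ∈
      mixedOrbit g f :=
    -- The restricted syzygy itself is the member of the orbit with exponent `0`.
    ⟨ModuleCat.of R (∀ i, E i), ModuleCat.of S (∀ i, Inflate ρ (E i)), _,
      ⟨m, E, hE, hinj, hall, ⟨LinearEquiv.refl R _⟩⟩,
      ⟨hfix, ⟨cornerPiInflateEquiv hρ fun i => E i⟩⟩,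
      ⟨_, _, hcov, ⟨LinearEquiv.refl S _⟩⟩, 0, ⟨LinearEquiv.refl T _⟩⟩
  have hsummand : ∀ i, IsDirectSummand (ModuleCat.of T (CornerOf g (Q i)))
      (restrictTo g (ModuleCat.of S (LinearMap.ker (LinearMap.piMap q)))) := fun i =>
    isDirectSummand_of_retract
      (e₂.symm.toLinearMap ∘ₗ LinearMap.single T (fun i => CornerOf g (Q i)) i)
      (LinearMap.proj i ∘ₗ e₂.toLinearMap) fun x =>
        (congrFun (e₂.apply_symm_apply (LinearMap.single T (fun i => CornerOf g (Q i)) i x)) i).trans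
          (Pi.single_eq_same (M := fun i => CornerOf g (Q i)) i x)
  have := isSemisimpleModule_quotient_jacobson (R := S) M
  obtain ⟨N, V, hV, ⟨e⟩⟩ := exists_linearEquiv_pi_simple (R := S) (M ⧸ Module.jacobson S M)
  have hVfix : ∀ j, ∀ v : V j, f 1 • v = v := by
    rintro j ⟨v, hv⟩
    obtain ⟨x, rfl⟩ := Submodule.Quotient.mk_surjective _ v
    exact Subtype.ext (congrArg Submodule.Quotient.mk (hM x))
  have hVE : ∀ j, ∃ i, Nonempty (V j ≃ₗ[S] Inflate ρ (E i)) := by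
    intro j
    have := hV j
    obtain ⟨i, ⟨t⟩⟩ := hall (ModuleCat.of R (CornerOf f (V j)))
      (isSimpleModule_corner hρ' (hVfix j))
    exact ⟨i, ⟨(equivInflateCorner hρ' (hVfix j)).trans (Inflate.congr ρ t)⟩⟩
  choose a ha using hVE
  let t : ∀ j, V j ≃ₗ[S] Inflate ρ (E (a j)) := fun j => (ha j).some
  -- By Nakayama the map from `M` to its top has superfluous kernel; uniqueness of covers then
  -- identifies `P` with the product of the `Q (a j)`.
  have hcov' := hp.comp (q := (Module.jacobson S M).mkQ) (Submodule.mkQ_surjective _)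
    fun _ hQ => IsNoetherian.eq_top_of_sup_eq_top (Submodule.ker_mkQ _).le hQ
  obtain ⟨d, -⟩ := (hcov'.comp_equiv (e.trans (LinearEquiv.piCongrRight t))).exists_equiv
    (ProjCover.pi fun j => hq (a j))
  exact ⟨N, fun j => ModuleCat.of T (CornerOf g (Q (a j))),
    fun j => ⟨_, hmem, hsummand (a j)⟩,
    ⟨(CornerOf.congr g d).trans (CornerOf.piEquiv g fun j => Q (a j))⟩⟩

/-- The opposite part of the syzygy of a module that lives on `R` has its class in the orbit
subgroup. -/
theorem cls_opposite_mem (h : IsDiagonalPair f g) {M P B : Type u} [AddCommGroup M]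
    [Module S M] [Module.Finite S M] [AddCommGroup P] [Module S P] {p : P →ₗ[S] M}
    (hp : ProjCover p) (hM : ∀ m : M, f 1 • m = m) [AddCommGroup B] [Module S B]
    [Module.Finite S B] (hB : ∀ x : B, g 1 • x = x)
    (e : CornerOf g B ≃ₗ[T] CornerOf g (LinearMap.ker p)) : K0.cls S B ∈ orbitSubgroup f g := by
  obtain ⟨e'⟩ := h.exists_equiv_opposite p hM
  exact AddSubgroup.subset_closure (Or.inr ⟨⟨ModuleCat.of S B, ‹_›⟩, _,
    h.corner_cover_mem_addClosure hp hM, ⟨hB, ⟨e.trans e'⟩⟩, rfl⟩)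

/-- A module that lives on `R` and has finite projective dimension: its projective dimension is
bounded by that over `R` and by a bound for the modules with class in the orbit subgroup. -/
theorem projDimLT_of_corner (h : IsDiagonalPair f g) {F : ℕ}
    (hF : ∀ (B : Type u) [AddCommGroup B] [Module S B] [Module.Finite S B] (d : ℕ),
      K0.cls S B ∈ orbitSubgroup f g → ProjDimLT S B d → ProjDimLT S B (F + 1)) (n : ℕ) :
    ∀ (M : Type u) [AddCommGroup M] [Module S M] [Module.Finite S M], (∀ m : M, f 1 • m = m) →
      ProjDimLT R (CornerOf f M) n → ∀ d, ProjDimLT S M d → ProjDimLT S M (n + (F + 1)) := by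
  induction n with
  | zero =>
    intro M _ _ _ hM hn d _
    have := ProjDimLT.zero_iff.1 hn
    -- The bound `0` means that the part vanishes, and the part is all of `M`.
    have h0 : ProjDimLT S M 0 := ProjDimLT.zero_iff.2 ⟨fun x y =>
      congrArg Subtype.val (this.elim (⟨x, hM x⟩ : CornerOf f M) ⟨y, hM y⟩)⟩
    exact h0.mono (Nat.zero_le _)
  | succ n ih =>
    intro M _ _ _ hM hn d hd
    obtain ⟨_, P, p, hp⟩ := ProjCover.exists_cover (R := S) M
    obtain ⟨A, B, _, _, hA, hB, ⟨e⟩, ⟨eA⟩, ⟨eB⟩⟩ := h.exists_ker_parts hp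
    have h1 := (ProjDimLT.iff_of_equiv_prod e).1
      ((hp.projDimLT_succ_iff d).1 (hd.mono (Nat.le_succ d)))
    have h2 := ((h.projCover_corner hp hM).projDimLT_succ_iff n).1 hn
    -- The `R`-part of the syzygy is the syzygy over `R`, with a smaller bound; the `T`-part falls
    -- under `hF` and leaves the induction.
    have h3 : ProjDimLT S A (n + (F + 1)) :=
      ih A hA (h2.congr (eA.trans (CornerOf.kerEquiv f p)).symm) d h1.1
    have h4 : ProjDimLT S B (F + 1) := hF B d (h.cls_opposite_mem hp hM hB eB) h1.2
    rw [Nat.add_right_comm]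
    exact (hp.projDimLT_succ_iff _).2
      ((ProjDimLT.iff_of_equiv_prod e).2 ⟨h3, h4.mono (Nat.le_add_left _ _)⟩)

variable [IsArtinianRing T]

/-- The two summands of the first syzygy have projective dimension at most `n + 1 + F`; the step
back to `M` adds one. The final `+ 1` comes from the strict inequality in `ProjDimLT`. -/
theorem projDimLT_of_bounds (h : IsDiagonalPair f g) {F n : ℕ}
    (hF : ∀ (B : Type u) [AddCommGroup B] [Module S B] [Module.Finite S B] (d : ℕ),
      K0.cls S B ∈ orbitSubgroup f g → ProjDimLT S B d → ProjDimLT S B (F + 1))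
    (hR : ∀ (X : Type u) [AddCommGroup X] [Module R X] [Module.Finite R X] (d : ℕ),
      ProjDimLT R X d → ProjDimLT R X (n + 1))
    (hT : ∀ (X : Type u) [AddCommGroup X] [Module T X] [Module.Finite T X] (d : ℕ),
      ProjDimLT T X d → ProjDimLT T X (n + 1))
    (M : Type u) [AddCommGroup M] [Module S M] [Module.Finite S M] (d : ℕ)
    (hd : ProjDimLT S M d) : ProjDimLT S M (n + 2 + F + 1) := by
  obtain ⟨_, P, p, hp⟩ := ProjCover.exists_cover (R := S) M
  obtain ⟨A, B, _, _, hA, hB, ⟨e⟩, -, -⟩ := h.exists_ker_parts hp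
  obtain ⟨h1, h2⟩ := (ProjDimLT.iff_of_equiv_prod e).1
    ((hp.projDimLT_succ_iff d).1 (hd.mono (Nat.le_succ d)))
  have := h.finite_corner hA
  have := h.symm.finite_corner hB
  have h3 : ProjDimLT S A (n + 1 + (F + 1)) := h.projDimLT_of_corner hF (n + 1) A hA
    (hR _ d (h.projDimLT_corner d A hA h1)) d h1
  have h4 : ProjDimLT S B (n + 1 + (F + 1)) := h.symm.projDimLT_of_corner
    (by rwa [orbitSubgroup_comm]) (n + 1) B hB (hT _ d (h.symm.projDimLT_corner d B hB h2)) d h2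
  exact ((hp.projDimLT_succ_iff _).2 ((ProjDimLT.iff_of_equiv_prod e).2 ⟨h3, h4⟩)).mono (by omega)

end IsDiagonalPair

/-! ## Finitistic dimensions -/

section Findim

variable {R : Type u} [Ring R]

theorem projectiveDimension_lt_top_iff {M : ModuleCat.{u} R} :
    projectiveDimension M < ⊤ ↔ ∃ d, ProjDimLT R M d := by
  rw [lt_top_iff_ne_top, projectiveDimension_ne_top_iff]
  exact ⟨fun ⟨n, hn⟩ => ⟨n + 1, hn⟩, fun ⟨n, hn⟩ => ⟨n, hn.mono (Nat.le_succ n)⟩⟩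

theorem findimOn_le_iff {X : Set (FGModuleCat.{u} R)} {n : ℕ} :
    findimOn X ≤ n ↔ ∀ (M : Type u) [AddCommGroup M] [Module R M] [Module.Finite R M] (d : ℕ),
      (⟨ModuleCat.of R M, ‹_›⟩ : FGModuleCat.{u} R) ∈ X → ProjDimLT R M d →
        ProjDimLT R M (n + 1) := by
  constructor
  · intro h M _ _ _ d hM hd
    exact (projectiveDimension_le_iff _ _).1 ((le_iSup (fun M : {M : FGModuleCat.{u} R //
      M ∈ X ∧ projectiveDimension M.obj < ⊤} => projectiveDimension M.1.obj)
      ⟨_, hM, projectiveDimension_lt_top_iff.2 ⟨d, hd⟩⟩).trans h)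
  · intro h
    refine iSup_le fun M => (projectiveDimension_le_iff _ _).2 ?_
    obtain ⟨d, hd⟩ := projectiveDimension_lt_top_iff.1 M.2.2
    have : Module.Finite R M.1.obj := M.1.property
    exact h M.1.obj d M.2.1 hd

/-- The zero module has projective dimension `⊥`, so a nonzero projective module in `X` is needed to
reach `0`; the ring itself serves. -/
theorem findimOn_nonneg [Nontrivial R] {X : Set (FGModuleCat.{u} R)}
    (hX : (⟨ModuleCat.of R R, inferInstanceAs (Module.Finite R R)⟩ : FGModuleCat.{u} R) ∈ X) :
    0 ≤ findimOn X := by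
  have : Projective (ModuleCat.of R R) := (IsProjective.iff_projective R).1 inferInstance
  have h0 := ModuleCat.projectiveDimension_eq_zero_of_projective (ModuleCat.of R R)
  exact h0.ge.trans (le_iSup (fun M : {M : FGModuleCat.{u} R //
    M ∈ X ∧ projectiveDimension M.obj < ⊤} => projectiveDimension M.1.obj)
    ⟨_, hX, h0.trans_lt (by decide)⟩)

theorem exists_nat_eq {x : WithBot ℕ∞} (h0 : 0 ≤ x) (h : x < ⊤) : ∃ n : ℕ, x = n := by
  induction x with
  | bot => exact absurd h0 (by simp)
  | coe y =>
    induction y with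
    | top => exact absurd h (lt_irrefl _)
    | coe n => exact ⟨n, rfl⟩

variable {S T : Type u} [Ring S] [Ring T] {f : R →ₙ+* S} {g : T →ₙ+* S}

theorem IsDiagonalPair.findim_lt_top_and_le [IsArtinianRing R] [IsArtinianRing S]
    [IsNoetherianRing S] [IsArtinianRing T] (h : IsDiagonalPair f g)
    (hsyz : K0.SyzygyFinite (orbitSubgroup f g)) (hR : findim R < ⊤) (hT : findim T < ⊤) :
    findim S < ⊤ ∧ ∀ M : FGModuleCat.{u} S, projectiveDimension M.obj < ⊤ →
      projectiveDimension M.obj ≤ max (findim R) (findim T) + 2 +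
        findimOn {N : FGModuleCat.{u} S | K0.mk N ∈ orbitSubgroup f g} := by
  -- Over the zero ring every projective dimension is `⊥`; otherwise one of the corners is nonzero
  -- and the maximum is a natural number.
  rcases subsingleton_or_nontrivial S with hS | hS
  · have hbot : ∀ M : ModuleCat.{u} S, projectiveDimension M = ⊥ := fun M => by
      rw [projectiveDimension_eq_bot_iff, ModuleCat.isZero_iff_subsingleton]
      exact Module.subsingleton S M
    refine ⟨lt_of_le_of_lt (iSup_le fun M => (hbot _).le) (bot_lt_top), fun M _ => ?_⟩
    rw [hbot]
    exact bot_le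
  have hmax : 0 ≤ max (findim R) (findim T) := by
    have : Nontrivial R ∨ Nontrivial T := by
      by_contra! hRT
      obtain ⟨h1, h2⟩ := hRT
      refine zero_ne_one (α := S) ?_
      rw [← h.add_one, Subsingleton.elim (1 : R) 0, Subsingleton.elim (1 : T) 0, map_zero,
        map_zero, add_zero]
    rcases this with h' | h'
    · exact le_max_of_le_left (findimOn_nonneg trivial)
    · exact le_max_of_le_right (findimOn_nonneg trivial)
  obtain ⟨n, hn⟩ := exists_nat_eq hmax (max_lt hR hT)
  obtain ⟨F₀, hF₀⟩ := hsyz.exists_bound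
  have hfin : findimOn {N : FGModuleCat.{u} S | K0.mk N ∈ orbitSubgroup f g} ≤ F₀ :=
    findimOn_le_iff.2 fun M _ _ _ d hM hd => hF₀ M d hM hd
  -- The bound from `SyzygyFinite.exists_bound` only shows finiteness; the estimate uses the exact
  -- value `F`. It is not `⊥` because the class of the free module is `0`, an element of the
  -- subgroup.
  obtain ⟨F, hF⟩ := exists_nat_eq
    (findimOn_nonneg (X := {N : FGModuleCat.{u} S | K0.mk N ∈ orbitSubgroup f g})
      (by
        have h0 : K0.cls S S = 0 := K0.cls_proj S
        change K0.cls S S ∈ orbitSubgroup f g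
        rw [h0]
        exact AddSubgroup.zero_mem _)) (hfin.trans_lt (WithBot.coe_lt_coe.2 (ENat.natCast_lt_top F₀)))
  have key := h.projDimLT_of_bounds (F := F) (n := n)
    (fun B _ _ _ d hB hd => findimOn_le_iff.1 hF.le B d hB hd)
    (fun X _ _ _ d hd => findimOn_le_iff.1 ((le_max_left _ _).trans hn.le) X d trivial hd)
    (fun X _ _ _ d hd => findimOn_le_iff.1 ((le_max_right _ _).trans hn.le) X d trivial hd)
  have hle : findim S ≤ ((n + 2 + F : ℕ) : WithBot ℕ∞) :=
    findimOn_le_iff.2 fun M _ _ _ d _ hd => key M d hd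
  refine ⟨hle.trans_lt (WithBot.coe_lt_coe.2 (ENat.natCast_lt_top _)), fun M hM => ?_⟩
  rw [hn, hF]
  refine (le_iSup (fun M : {M : FGModuleCat.{u} S //
    M ∈ Set.univ ∧ projectiveDimension M.obj < ⊤} => projectiveDimension M.1.obj)
    ⟨M, trivial, hM⟩).trans (hle.trans (le_of_eq ?_))
  push_cast
  rfl

end Findim

/-! ### Corner projections and computations with paths -/

/-- The map `s ↦ f 1 * s * f 1`, read in `R` through the injective `f`, is always additive; `hz` is
exactly its multiplicativity. -/
theorem exists_corner_projection {R S : Type u} [Ring R] [Ring S] (f : R →ₙ+* S)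
    (hf : Function.Injective f) (hs : ∀ s, ∃ r, f r = f 1 * s * f 1)
    (hz : ∀ s s', f 1 * (s * s') * f 1 = f 1 * s * f 1 * (f 1 * s' * f 1)) :
    ∃ ρ : S →+* R, (∀ r, ρ (f r) = r) ∧ ∀ s, f (ρ s) = f 1 * s * f 1 := by
  choose ρ hρ using hs
  refine ⟨{ toFun := ρ, map_one' := hf ?_, map_mul' := fun s t => hf ?_, map_zero' := hf ?_,
            map_add' := fun s t => hf ?_ }, fun r => hf ?_, hρ⟩
  · rw [hρ, mul_one, ← map_mul, mul_one]
  · rw [hρ, map_mul, hρ, hρ, hz]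
  · rw [hρ, mul_zero, zero_mul, map_zero]
  · rw [hρ, map_add, hρ, hρ, mul_add, add_mul]
  · change f (ρ (f r)) = f r
    rw [hρ, ← map_mul, ← map_mul, one_mul, mul_one]

namespace PathAlgebra

variable {k : Type u} [Field k] {V : Type u} [Quiver.{u} V]

theorem mem_of_coeff {N : Submodule k (PathAlgebra k V)} {x : PathAlgebra k V}
    (h : ∀ p, coeff x p ≠ 0 → ofPath k p ∈ N) : x ∈ N := by
  have h1 : (show AllPaths V →₀ k from x).sum (fun p c => c • ofPath k p) = x := by
    refine Eq.trans ?_ (Finsupp.sum_single (show AllPaths V →₀ k from x))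
    refine Finsupp.sum_congr fun p _ => ?_
    exact (Finsupp.smul_single _ _ _).trans (by rw [smul_eq_mul, mul_one])
  rw [← h1]
  exact Submodule.sum_mem _ fun p hp => N.smul_mem _ (h p (Finsupp.mem_support_iff.1 hp))

variable (k) in
/-- The basis element that belongs to a path with given ends. -/
noncomputable abbrev single {a b : V} (p : Quiver.Path a b) : PathAlgebra k V := ofPath k ⟨a, b, p⟩

theorem single_mul_single {a b c : V} (p : Quiver.Path a b) (q : Quiver.Path b c) :
    single k p * single k q = single k (p.comp q) := by
  rw [ofPath_mul_ofPath]
  exact dif_pos rfl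

theorem ofPath_mul_ofPath_of_ne {p q : AllPaths V} (h : p.2.1 ≠ q.1) :
    ofPath k p * ofPath k q = 0 := by
  rw [ofPath_mul_ofPath]
  exact dif_neg h

theorem coeff_ofPath [DecidableEq (AllPaths V)] (p q : AllPaths V) :
    coeff (ofPath k p) q = if p = q then 1 else 0 :=
  Finsupp.single_apply

variable [Fintype V]

variable (k) in
/-- The coefficient of the trivial path at a vertex is a character of the path algebra. -/
noncomputable def vertexCharacter (v : V) : PathAlgebra k V →+* k where
  toFun x := coeff x (AllPaths.triv v)
  map_zero' := rfl
  map_add' _ _ := rfl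
  map_one' := by
    classical
    have h1 : coeff (1 : PathAlgebra k V) (AllPaths.triv v) =
        ∑ w : V, coeff (ofPath k (AllPaths.triv w)) (AllPaths.triv v) :=
      map_sum (Finsupp.lapply (R := k) (M := k) (AllPaths.triv v))
        (fun w => ofPath k (AllPaths.triv w)) Finset.univ
    rw [h1, Finset.sum_eq_single v]
    · rw [coeff_ofPath, if_pos rfl]
    · intro w _ hw
      rw [coeff_ofPath, if_neg fun h => hw (congrArg Sigma.fst h)]
    · exact fun h => absurd (Finset.mem_univ _) h
  map_mul' x y := by
    classical
    let φ : PathAlgebra k V →ₗ[k] k := Finsupp.lapply (AllPaths.triv v)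
    have hφ : ∀ p, φ (ofPath k p) = if p = AllPaths.triv v then 1 else 0 := fun p =>
      coeff_ofPath p _
    have key : (LinearMap.llcomp k _ _ _ φ).comp (mulHom k V) =
        (LinearMap.mul k k).compl₁₂ φ φ := by
      refine hom_ext fun p => hom_ext fun q => ?_
      simp only [LinearMap.comp_apply, LinearMap.llcomp_apply, LinearMap.compl₁₂_apply, ← mul_def,
        LinearMap.mul_apply', hφ]
      obtain ⟨a, b, p⟩ := p
      obtain ⟨c, d, q⟩ := q
      by_cases h : b = c
      · subst h
        have h1 := single_mul_single (k := k) p q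
        rw [h1, hφ]
        -- A product of composable paths is trivial only if both factors are; if `q` ends with an
        -- arrow, both sides are zero.
        cases q with
        | nil =>
          rw [Quiver.Path.comp_nil]
          by_cases h2 : (⟨a, b, p⟩ : AllPaths V) = AllPaths.triv v
          · have h3 : b = v := congrArg (fun z : AllPaths V => z.2.1) h2
            subst h3
            rw [if_pos h2, one_mul]
            exact (if_pos rfl).symm
          · rw [if_neg h2, zero_mul]
        | cons q e =>
          have h2 : ∀ {a' b' : V} (r : Quiver.Path a' b'), 0 < r.length →
              (⟨a', b', r⟩ : AllPaths V) ≠ AllPaths.triv v := fun r hr h => by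
            have h3 := congrArg AllPaths.length h
            exact hr.ne' h3
          rw [if_neg (h2 _ (by simp)), if_neg (h2 (q.cons e) (by simp)), mul_zero]
      · rw [ofPath_mul_ofPath_of_ne h, map_zero]
        by_cases h2 : (⟨a, b, p⟩ : AllPaths V) = AllPaths.triv v
        · have h3 : b = v := congrArg (fun z : AllPaths V => z.2.1) h2
          rw [if_neg (c := (⟨c, d, q⟩ : AllPaths V) = AllPaths.triv v)
            fun h' => h (h3.trans (congrArg Sigma.fst h').symm), mul_zero]
        · rw [if_neg h2, zero_mul]
    exact LinearMap.congr_fun (LinearMap.congr_fun key x) y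

/-- Elements of the Jacobson radical of a bound quiver algebra have no trivial paths. -/
theorem coeff_triv_eq_zero {I : Ideal (PathAlgebra k V)} [I.IsTwoSided] (hI : IsAdmissible I)
    {x : BoundQuiverOp I} (hx : x ∈ Ring.jacobson (BoundQuiverOp I)) {y : PathAlgebra k V}
    (hy : x = MulOpposite.op (Ideal.Quotient.mk I y)) (v : V) :
    coeff y (AllPaths.triv v) = 0 := by
  -- Elements of an admissible ideal have no trivial paths, so the character descends to the
  -- quotient. A surjective ring homomorphism maps the radical into that of `k`, which is zero.
  let χ : PathAlgebra k V ⧸ I →+* k := Ideal.Quotient.lift I (vertexCharacter k v)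
    fun z hz => by
      by_contra h
      exact absurd (hI.1 z hz _ h) (by simp [AllPaths.length, AllPaths.triv])
  let χ' : BoundQuiverOp I →+* k := χ.fromOpposite fun a b => mul_comm _ _
  have hsurj : Function.Surjective χ' := by
    intro c
    refine ⟨MulOpposite.op (Ideal.Quotient.mk I (c • 1)), ?_⟩
    change c * vertexCharacter k v 1 = c
    rw [map_one, mul_one]
  have : RingHomSurjective χ' := ⟨hsurj⟩
  have h1 : χ' x ∈ Ring.jacobson k := Ring.le_comap_jacobson χ' hx
  rw [IsSemisimpleRing.jacobson_eq_bot] at h1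
  rw [hy] at h1
  exact h1

variable {W : Type u} [Quiver.{u} W] [Fintype W] (F : V ⥤q W) (hF : Function.Injective F.obj)

theorem map_single {a b : V} (p : Quiver.Path a b) :
    map F hF (single k p) = single k (F.mapPath p) :=
  lift_ofPath _ _

theorem map_one_eq : map F hF (1 : PathAlgebra k V) =
    ∑ a : V, ofPath k (AllPaths.triv (F.obj a)) := by
  rw [one_def, map_sum]
  exact Finset.sum_congr rfl fun a _ => map_single F hF Quiver.Path.nil

theorem map_one_mul_of_mem {q : AllPaths W} (hq : ∃ a, F.obj a = q.1) :
    map F hF (1 : PathAlgebra k V) * ofPath k q = ofPath k q := by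
  obtain ⟨a, ha⟩ := hq
  rw [map_one_eq, Finset.sum_mul, Finset.sum_eq_single a]
  · obtain ⟨b, c, q⟩ := q
    subst ha
    exact (single_mul_single Quiver.Path.nil q).trans (by rw [Quiver.Path.nil_comp])
  · intro a' _ h
    exact ofPath_mul_ofPath_of_ne fun h' => h (hF (h'.trans ha.symm))
  · exact fun h => absurd (Finset.mem_univ _) h

theorem map_one_mul_of_notMem {q : AllPaths W} (hq : ∀ a, F.obj a ≠ q.1) :
    map F hF (1 : PathAlgebra k V) * ofPath k q = 0 := by
  rw [map_one_eq, Finset.sum_mul]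
  exact Finset.sum_eq_zero fun a _ => ofPath_mul_ofPath_of_ne (hq a)

theorem mul_map_one_of_mem {q : AllPaths W} (hq : ∃ a, F.obj a = q.2.1) :
    ofPath k q * map F hF (1 : PathAlgebra k V) = ofPath k q := by
  obtain ⟨a, ha⟩ := hq
  rw [map_one_eq, Finset.mul_sum, Finset.sum_eq_single a]
  · obtain ⟨b, c, q⟩ := q
    subst ha
    exact single_mul_single q Quiver.Path.nil
  · intro a' _ h
    exact ofPath_mul_ofPath_of_ne fun h' => h (hF (h'.symm.trans ha.symm))
  · exact fun h => absurd (Finset.mem_univ _) h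

theorem mul_map_one_of_notMem {q : AllPaths W} (hq : ∀ a, F.obj a ≠ q.2.1) :
    ofPath k q * map F hF (1 : PathAlgebra k V) = 0 := by
  rw [map_one_eq, Finset.mul_sum]
  exact Finset.sum_eq_zero fun a _ => ofPath_mul_ofPath_of_ne (hq a).symm

end PathAlgebra

/-! ### Ideals on a quiver glued from two full subquivers -/

namespace PathAlgebra

variable {k : Type u} [Field k] {VA VB W : Type u} [Quiver.{u} VA] [Quiver.{u} VB] [Quiver.{u} W]
  [Fintype W]

/-- The quiver `W` consists of two full subquivers and arrows between them, and the ideal `I`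
contains the nontrivial paths whose last arrow leads from one subquiver to the other. -/
structure IsMixedIdeal (F : VA ⥤q W) (G : VB ⥤q W) (I : Ideal (PathAlgebra k W)) : Prop where
  injective_left : Function.Injective F.obj
  injective_right : Function.Injective G.obj
  ne : ∀ a b, F.obj a ≠ G.obj b
  cover : ∀ w, (∃ a, F.obj a = w) ∨ ∃ b, G.obj b = w
  full_left : ∀ {a a'} (e : F.obj a ⟶ F.obj a'), ∃ e', e = F.map e'
  full_right : ∀ {b b'} (e : G.obj b ⟶ G.obj b'), ∃ e', e = G.map e'
  left_right : ∀ {w a b} (r : Quiver.Path w (F.obj a)) (e : F.obj a ⟶ G.obj b), 0 < r.length →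
    single k (r.cons e) ∈ I
  right_left : ∀ {w a b} (r : Quiver.Path w (G.obj b)) (e : G.obj b ⟶ F.obj a), 0 < r.length →
    single k (r.cons e) ∈ I

namespace IsMixedIdeal

variable {F : VA ⥤q W} {G : VB ⥤q W} {I : Ideal (PathAlgebra k W)}

theorem symm (h : IsMixedIdeal F G I) : IsMixedIdeal G F I :=
  ⟨h.injective_right, h.injective_left, fun a b => (h.ne b a).symm, fun w => (h.cover w).symm,
    h.full_right, h.full_left, h.right_left, h.left_right⟩

section

variable [Fintype VA] [Fintype VB]

/-- `x ↦ a x b` as a linear map. -/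
noncomputable def mulMul (a b : PathAlgebra k W) : PathAlgebra k W →ₗ[k] PathAlgebra k W :=
  LinearMap.mulRight k b ∘ₗ LinearMap.mulLeft k a

theorem add_one (h : IsMixedIdeal F G I) :
    map F h.injective_left (1 : PathAlgebra k VA) + map G h.injective_right 1 = 1 := by
  have key : LinearMap.mulLeft k
      (map F h.injective_left (1 : PathAlgebra k VA) + map G h.injective_right 1) =
      LinearMap.id := by
    refine hom_ext fun q => ?_
    rw [LinearMap.mulLeft_apply, add_mul]
    rcases h.cover q.1 with ⟨a, ha⟩ | ⟨b, hb⟩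
    · rw [map_one_mul_of_mem F _ ⟨a, ha⟩,
        map_one_mul_of_notMem G _ fun b hb => h.ne a b (ha.trans hb.symm), add_zero]
      rfl
    · rw [map_one_mul_of_mem G _ ⟨b, hb⟩,
        map_one_mul_of_notMem F _ fun a ha => h.ne a b (ha.trans hb.symm), zero_add]
      rfl
  have h1 := LinearMap.congr_fun key 1
  rwa [LinearMap.mulLeft_apply, mul_one] at h1

theorem sandwich_ofPath (h : IsMixedIdeal F G I) (q : AllPaths W) :
    map F h.injective_left (1 : PathAlgebra k VA) * ofPath k q *
      map G h.injective_right (1 : PathAlgebra k VB) = 0 ∨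
    ((∃ a, F.obj a = q.1) ∧ (∃ b, G.obj b = q.2.1) ∧
      map F h.injective_left (1 : PathAlgebra k VA) * ofPath k q *
        map G h.injective_right (1 : PathAlgebra k VB) = ofPath k q) := by
  by_cases h1 : ∃ a, F.obj a = q.1
  · by_cases h2 : ∃ b, G.obj b = q.2.1
    · exact Or.inr ⟨h1, h2, by rw [map_one_mul_of_mem F _ h1, mul_map_one_of_mem G _ h2]⟩
    · rw [map_one_mul_of_mem F _ h1]
      exact Or.inl (mul_map_one_of_notMem G _ fun b hb => h2 ⟨b, hb⟩)
  · left
    rw [map_one_mul_of_notMem F _ fun a ha => h1 ⟨a, ha⟩, zero_mul]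

end

variable [I.IsTwoSided]

theorem single_cons_mem {u v w : W} {p : Quiver.Path u v} (hp : single k p ∈ I) (e : v ⟶ w) :
    single k (p.cons e) ∈ I := by
  have h1 := I.mul_mem_right (single k e.toPath) hp
  rwa [single_mul_single] at h1

/-- The paths that start in the left subquiver and do not vanish: those that stay there, and those
that leave it with their first arrow. -/
theorem path_cases (h : IsMixedIdeal F G I) {a : VA} {w : W} (q : Quiver.Path (F.obj a) w) :
    (∀ a' (e : w = F.obj a'), (∃ q' : Quiver.Path a a', q.cast rfl e = F.mapPath q') ∨
      single k q ∈ I) ∧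
    ((∃ b, G.obj b = w) → ∀ {u : W} (p : Quiver.Path u (F.obj a)), 0 < p.length →
      single k (p.comp q) ∈ I) := by
  induction q with
  | nil =>
    refine ⟨fun a' e => Or.inl ?_, fun ⟨b, hb⟩ => absurd hb.symm (h.ne a b)⟩
    cases h.injective_left e
    exact ⟨Quiver.Path.nil, rfl⟩
  | @cons v w q e ih =>
    constructor
    · rintro a' rfl
      rcases h.cover v with ⟨a'', rfl⟩ | ⟨b, rfl⟩
      · rcases ih.1 a'' rfl with ⟨q', hq'⟩ | hq
        · obtain ⟨e', rfl⟩ := h.full_left e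
          have hq'' : q = F.mapPath q' := hq'
          exact Or.inl ⟨q'.cons e', by rw [hq'']; rfl⟩
        · exact Or.inr (single_cons_mem hq e)
      -- The path `q` joins vertices on different sides, so it is nontrivial and the crossing arrow
      -- `e` is not the first one.
      · exact Or.inr (h.right_left q e (Nat.pos_of_ne_zero fun h0 =>
          h.ne a b (Quiver.Path.eq_of_length_zero q h0)))
    · rintro ⟨b, rfl⟩ u p hp
      rw [Quiver.Path.comp_cons]
      rcases h.cover v with ⟨a', rfl⟩ | ⟨b', rfl⟩
      -- Here `e` may be the first arrow after `p`; it is the prefix `p` that puts the path into the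
      -- ideal.
      · exact h.left_right _ e (by rw [Quiver.Path.length_comp]; omega)
      · exact single_cons_mem (ih.2 ⟨b', rfl⟩ p hp) e

theorem mul_mem_of_path (h : IsMixedIdeal F G I) {p q : AllPaths W} (hp : 0 < p.length)
    (hq : ∃ a, F.obj a = q.1) (hq' : ∃ b, G.obj b = q.2.1) : ofPath k p * ofPath k q ∈ I := by
  obtain ⟨u, v, p⟩ := p
  obtain ⟨v', w, q⟩ := q
  obtain ⟨a, rfl⟩ := hq
  by_cases e : v = F.obj a
  · subst e
    have h1 := single_mul_single (k := k) p q
    rw [h1]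
    exact (h.path_cases q).2 hq' p hp
  · rw [ofPath_mul_ofPath_of_ne e]
    exact I.zero_mem

variable [Fintype VA] [Fintype VB]

/-- The off-diagonal part annihilates the elements without trivial paths. -/
theorem mul_sandwich_mem (h : IsMixedIdeal F G I) {y : PathAlgebra k W}
    (hy : ∀ w, coeff y (AllPaths.triv w) = 0) (z : PathAlgebra k W) :
    y * (map F h.injective_left (1 : PathAlgebra k VA) * z *
      map G h.injective_right (1 : PathAlgebra k VB)) ∈ I := by
  set c := map F h.injective_left (1 : PathAlgebra k VA)
  set d := map G h.injective_right (1 : PathAlgebra k VB)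
  change z ∈ (I.restrictScalars k).comap (LinearMap.mulLeft k y ∘ₗ mulMul c d)
  refine mem_of_coeff fun q _ => ?_
  change y * (c * ofPath k q * d) ∈ I
  change y ∈ (I.restrictScalars k).comap (LinearMap.mulRight k (c * ofPath k q * d))
  refine mem_of_coeff fun p hp => ?_
  change ofPath k p * (c * ofPath k q * d) ∈ I
  rcases h.sandwich_ofPath q with h1 | ⟨h1, h2, h3⟩
  · rw [h1, mul_zero]
    exact I.zero_mem
  · rw [h3]
    refine h.mul_mem_of_path (Nat.pos_of_ne_zero fun h0 => ?_) h1 h2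
    obtain ⟨u, v, p⟩ := p
    cases p with
    | nil => exact hp (hy u)
    | cons p e => exact absurd h0 (Nat.succ_ne_zero _)

/-- The products of two opposite off-diagonal parts vanish. -/
theorem sandwich_mul_sandwich_mem (h : IsMixedIdeal F G I) (y z : PathAlgebra k W) :
    (map F h.injective_left (1 : PathAlgebra k VA) * y *
      map G h.injective_right (1 : PathAlgebra k VB)) *
    (map G h.injective_right (1 : PathAlgebra k VB) * z *
      map F h.injective_left (1 : PathAlgebra k VA)) ∈ I := by
  -- The left factor has no trivial paths, because its paths run from one side to the other, so the
  -- previous lemma applies with the sides exchanged.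
  refine h.symm.mul_sandwich_mem (fun w => ?_) z
  set c := map F h.injective_left (1 : PathAlgebra k VA)
  set d := map G h.injective_right (1 : PathAlgebra k VB)
  let N : Submodule k (PathAlgebra k W) :=
    LinearMap.ker (Finsupp.lapply (R := k) (M := k) (AllPaths.triv w) : (AllPaths W →₀ k) →ₗ[k] k)
  change y ∈ N.comap (mulMul c d)
  refine mem_of_coeff fun q _ => ?_
  change coeff (c * ofPath k q * d) (AllPaths.triv w) = 0
  rcases h.sandwich_ofPath q with h1 | ⟨⟨a, ha⟩, ⟨b, hb⟩, h3⟩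
  · rw [h1]
    rfl
  · classical
    rw [h3, coeff_ofPath, if_neg]
    rintro rfl
    exact h.ne a b (ha.trans hb.symm)

-- A path with both ends on the left either stays there or lies in `I`, by `path_cases`. So modulo
-- `I` the corner is no larger than the image of the left path algebra.
omit [Fintype VB] in
theorem sandwich_self (h : IsMixedIdeal F G I) (z : PathAlgebra k W) :
    ∃ x : PathAlgebra k VA, map F h.injective_left x -
      map F h.injective_left (1 : PathAlgebra k VA) * z * map F h.injective_left 1 ∈ I := by
  set c := map F h.injective_left (1 : PathAlgebra k VA)
  let L : PathAlgebra k VA →ₗ[k] PathAlgebra k W :=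
    lift fun p => ofPath k ⟨F.obj p.1, F.obj p.2.1, F.mapPath p.2.2⟩
  suffices hz : z ∈ (LinearMap.range L ⊔ I.restrictScalars k).comap (mulMul c c) by
    obtain ⟨_, ⟨x, rfl⟩, i, hi, hxi⟩ := Submodule.mem_sup.1 hz
    refine ⟨x, ?_⟩
    have h1 : L x + i = c * z * c := hxi
    have h2 : L x - c * z * c = -i := by rw [← h1]; abel
    change L x - c * z * c ∈ I
    rw [h2]
    exact I.neg_mem hi
  refine mem_of_coeff fun q _ => ?_
  change c * ofPath k q * c ∈ LinearMap.range L ⊔ I.restrictScalars k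
  by_cases h1 : ∃ a, F.obj a = q.1
  · by_cases h2 : ∃ a, F.obj a = q.2.1
    · rw [map_one_mul_of_mem F _ h1, mul_map_one_of_mem F _ h2]
      obtain ⟨u, v, q⟩ := q
      obtain ⟨a, rfl⟩ := h1
      obtain ⟨a', rfl⟩ := h2
      rcases (h.path_cases q).1 a' rfl with ⟨q', hq'⟩ | hq
      · refine Submodule.mem_sup_left ⟨single k q', ?_⟩
        have hq'' : q = F.mapPath q' := hq'
        rw [hq'']
        exact lift_ofPath _ _
      · exact Submodule.mem_sup_right hq
    · rw [map_one_mul_of_mem F _ h1, mul_map_one_of_notMem F _ fun a ha => h2 ⟨a, ha⟩]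
      exact Submodule.zero_mem _
  · rw [map_one_mul_of_notMem F _ fun a ha => h1 ⟨a, ha⟩, zero_mul]
    exact Submodule.zero_mem _

variable {IA : Ideal (PathAlgebra k VA)} [IA.IsTwoSided]

/-- The inclusion of the left corner, on opposite algebras. -/
noncomputable abbrev opMap (h : IsMixedIdeal F G I)
    (hA : ∀ x, x ∈ IA ↔ map F h.injective_left x ∈ I) : BoundQuiverOp IA →ₙ+* BoundQuiverOp I :=
  NonUnitalRingHom.op (quotientMap (map F h.injective_left) fun x => (hA x).1)

/-- Injectivity is `hA`, surjectivity onto the corner is `sandwich_self`, and multiplicativity holds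
because detours through the other side vanish. -/
theorem exists_left (h : IsMixedIdeal F G I) (hA : ∀ x, x ∈ IA ↔ map F h.injective_left x ∈ I) :
    ∃ ρ : BoundQuiverOp I →+* BoundQuiverOp IA, (∀ r, ρ (h.opMap hA r) = r) ∧
      ∀ s, h.opMap hA (ρ s) = h.opMap hA 1 * s * h.opMap hA 1 := by
  refine exists_corner_projection _ ?_ ?_ ?_
  · refine (injective_iff_map_eq_zero _).2 fun r hr => ?_
    obtain ⟨x, hx⟩ := Ideal.Quotient.mk_surjective (MulOpposite.unop r)
    have h1 : Ideal.Quotient.mk I (map F h.injective_left x) = 0 := by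
      have h2 := congrArg MulOpposite.unop hr
      change quotientMap (map F h.injective_left) (fun x => (hA x).1) (MulOpposite.unop r) = 0 at h2
      rw [← hx] at h2
      exact h2
    refine MulOpposite.unop_injective (hx.symm.trans ?_)
    exact Ideal.Quotient.eq_zero_iff_mem.2 ((hA x).2 (Ideal.Quotient.eq_zero_iff_mem.1 h1))
  · intro s
    obtain ⟨z, hz⟩ := Ideal.Quotient.mk_surjective (MulOpposite.unop s)
    obtain ⟨x, hx⟩ := h.sandwich_self z
    refine ⟨MulOpposite.op (Ideal.Quotient.mk IA x), MulOpposite.unop_injective ?_⟩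
    have h1 := (Ideal.Quotient.mk_eq_mk_iff_sub_mem _ _).2 hx
    rw [mul_assoc, map_mul, map_mul, hz] at h1
    exact h1
  · intro s s'
    obtain ⟨z, hz⟩ := Ideal.Quotient.mk_surjective (MulOpposite.unop s)
    obtain ⟨z', hz'⟩ := Ideal.Quotient.mk_surjective (MulOpposite.unop s')
    refine MulOpposite.unop_injective ?_
    set c := map F h.injective_left (1 : PathAlgebra k VA) with hc
    set d := map G h.injective_right (1 : PathAlgebra k VB) with hd
    have hcc : c * c = c := by rw [hc, ← map_mul, one_mul]
    have hdd : d * d = d := by rw [hd, ← map_mul, one_mul]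
    have hcd : c + d = 1 := h.add_one
    -- The idempotents `c + d = 1` are inserted between the factors, whose order is reversed by
    -- passing to the opposite ring.
    have h2 : c * (z' * z) * c - (c * z' * c) * (c * z * c) = (c * z' * d) * (d * z * c) := by
      have e1 : (c * z' * c) * (c * z * c) = c * z' * (c * c) * z * c := by noncomm_ring
      have e2 : (c * z' * d) * (d * z * c) = c * z' * (d * d) * z * c := by noncomm_ring
      have e3 : c * (z' * z) * c = c * z' * (c + d) * z * c := by rw [hcd]; noncomm_ring
      rw [e1, e2, e3, hcc, hdd]
      noncomm_ring
    have h1 : c * (z' * z) * c - (c * z' * c) * (c * z * c) ∈ I := by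
      rw [h2]
      exact h.sandwich_mul_sandwich_mem z' z
    have h3 := (Ideal.Quotient.mk_eq_mk_iff_sub_mem _ _).2 h1
    rw [mul_assoc c, mul_assoc c z', mul_assoc c z] at h3
    simp only [map_mul, hz, hz'] at h3
    exact h3

/-- Radical elements have no trivial paths, so `mul_sandwich_mem` applies; there the radical element
stands on the left, which is the right in the opposite ring. -/
theorem radical_left (h : IsMixedIdeal F G I) (hI : IsAdmissible I)
    {IB : Ideal (PathAlgebra k VB)} [IB.IsTwoSided]
    (hA : ∀ x, x ∈ IA ↔ map F h.injective_left x ∈ I)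
    (hB : ∀ x, x ∈ IB ↔ map G h.injective_right x ∈ I) (s x : BoundQuiverOp I)
    (hx : x ∈ Ring.jacobson (BoundQuiverOp I)) :
    h.symm.opMap hB 1 * s * h.opMap hA 1 * x = 0 := by
  obtain ⟨y, hy⟩ := Ideal.Quotient.mk_surjective (MulOpposite.unop x)
  obtain ⟨z, hz⟩ := Ideal.Quotient.mk_surjective (MulOpposite.unop s)
  have h1 := h.mul_sandwich_mem (coeff_triv_eq_zero hI hx (congrArg MulOpposite.op hy.symm)) z
  have h2 := Ideal.Quotient.eq_zero_iff_mem.2 h1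
  rw [mul_assoc (map F h.injective_left (1 : PathAlgebra k VA))] at h2
  simp only [map_mul, hy, hz] at h2
  exact MulOpposite.unop_injective h2

theorem isDiagonalPair (h : IsMixedIdeal F G I) (hI : IsAdmissible I)
    {IB : Ideal (PathAlgebra k VB)} [IB.IsTwoSided]
    (hA : ∀ x, x ∈ IA ↔ map F h.injective_left x ∈ I)
    (hB : ∀ x, x ∈ IB ↔ map G h.injective_right x ∈ I) :
    IsDiagonalPair (h.opMap hA) (h.symm.opMap hB) where
  add_one := MulOpposite.unop_injective
    (congrArg (Ideal.Quotient.mk I) h.add_one)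
  exists_left := h.exists_left hA
  exists_right := h.symm.exists_left hB
  left_radical := h.radical_left hI hA hB
  right_radical := h.symm.radical_left hI hB hA

end IsMixedIdeal

end PathAlgebra

/-! ### The square quiver and the theorem -/

namespace SquareQuiver

variable {k : Type u} [Field k] {VA VB : Type u} [Fintype VA] [Fintype VB] [Quiver.{u} VA]
  [Quiver.{u} VB] {J : VA → VB → Type u} {K : VB → VA → Type u}

/-- An arrow that ends where some `α_j` starts is an arrow of `Q_A` or some `β_l`, and both products
with `α_j` are mixed relations; likewise for `β_l`. So any crossing arrow preceded by another arrow
gives an element of `I`. -/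
theorem isMixedIdeal {I : Ideal (PathAlgebra k (SquareQuiver J K))} [I.IsTwoSided]
    (hI : ∀ x, MixedRelation J K k x → x ∈ I) :
    PathAlgebra.IsMixedIdeal (inclA J K) (inclB J K) I where
  injective_left := inclA_injective J K
  injective_right := inclB_injective J K
  ne _ _ h := Sum.inl_ne_inr (congrArg vertex h)
  cover := by
    rintro ⟨a | b⟩
    · exact Or.inl ⟨a, rfl⟩
    · exact Or.inr ⟨b, rfl⟩
  full_left := by rintro a a' (e | _); exact ⟨e, rfl⟩
  full_right := by rintro b b' (_ | e); exact ⟨e, rfl⟩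
  left_right := by
    intro w a b r e hr
    -- Only the last two arrows matter, since the rest of the path is a left factor.
    have key : ∀ {v : SquareQuiver J K} (r : Quiver.Path w v)
        (e' : v ⟶ (inclA J K).obj a),
        PathAlgebra.arrow k e' * PathAlgebra.arrow k e ∈ I →
        PathAlgebra.single k ((r.cons e').cons e) ∈ I := by
      intro v r e' h
      have h1 := I.mul_mem_left (PathAlgebra.single k r) h
      have h2 : PathAlgebra.arrow k e' * PathAlgebra.arrow k e =
        PathAlgebra.single k (e'.toPath.comp e.toPath) := PathAlgebra.single_mul_single _ _
      rw [h2, PathAlgebra.single_mul_single] at h1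
      exact h1
    cases r with
    | nil => exact absurd hr (lt_irrefl 0)
    | cons r e' =>
      refine key r e' (hI _ ?_)
      change Arrow J K ⟨Sum.inl a⟩ ⟨Sum.inr b⟩ at e
      cases e with
      | ofJ j =>
        change Arrow J K _ ⟨Sum.inl a⟩ at e'
        cases e' with
        | inA f => exact MixedRelation.arrowA_J f j
        | ofK l => exact MixedRelation.K_J l j
  right_left := by
    intro w a b r e hr
    have key : ∀ {v : SquareQuiver J K} (r : Quiver.Path w v)
        (e' : v ⟶ (inclB J K).obj b),
        PathAlgebra.arrow k e' * PathAlgebra.arrow k e ∈ I →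
        PathAlgebra.single k ((r.cons e').cons e) ∈ I := by
      intro v r e' h
      have h1 := I.mul_mem_left (PathAlgebra.single k r) h
      have h2 : PathAlgebra.arrow k e' * PathAlgebra.arrow k e =
        PathAlgebra.single k (e'.toPath.comp e.toPath) := PathAlgebra.single_mul_single _ _
      rw [h2, PathAlgebra.single_mul_single] at h1
      exact h1
    cases r with
    | nil => exact absurd hr (lt_irrefl 0)
    | cons r e' =>
      refine key r e' (hI _ ?_)
      change Arrow J K ⟨Sum.inr b⟩ ⟨Sum.inl a⟩ at e
      cases e with
      | ofK l =>
        change Arrow J K _ ⟨Sum.inr b⟩ at e'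
        cases e' with
        | inB g => exact MixedRelation.arrowB_K g l
        | ofJ j => exact MixedRelation.J_K j l

end SquareQuiver

theorem theorem3p7 {k : Type u} [Field k]
    -- the finite quivers `Q_A`, `Q_B`, and the finitely many arrows `α_j`, `β_k` between them
    {VA VB : Type u} [Fintype VA] [Fintype VB] [Quiver.{u} VA] [Quiver.{u} VB]
    [∀ a a' : VA, Finite (a ⟶ a')] [∀ b b' : VB, Finite (b ⟶ b')]
    (J : VA → VB → Type u) (K : VB → VA → Type u)
    [∀ a b, Finite (J a b)] [∀ b a, Finite (K b a)]
    -- the admissible ideals `I_A`, `I_B`, `I_C`, with finite dimensional quotient algebras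
    (IA : Ideal (PathAlgebra k VA)) [IA.IsTwoSided]
    (IB : Ideal (PathAlgebra k VB)) [IB.IsTwoSided]
    (IC : Ideal (PathAlgebra k (SquareQuiver J K))) [IC.IsTwoSided]
    (hIA : PathAlgebra.IsAdmissible IA) (hIB : PathAlgebra.IsAdmissible IB)
    (hIC : PathAlgebra.IsAdmissible IC)
    [FiniteDimensional k (PathAlgebra k VA ⧸ IA)] [FiniteDimensional k (PathAlgebra k VB ⧸ IB)]
    [FiniteDimensional k (PathAlgebra k (SquareQuiver J K) ⧸ IC)]
    -- `I_C` contains `I_A`, `I_B`, and induces no further relations on `Q_A` and `Q_B`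
    (hA : ∀ x, x ∈ IA ↔ SquareQuiver.algInclA J K k x ∈ IC)
    (hB : ∀ x, x ∈ IB ↔ SquareQuiver.algInclB J K k x ∈ IC)
    -- `I_C` contains the mixed relations
    (hmixed : ∀ x, SquareQuiver.MixedRelation J K k x → x ∈ IC)
    -- the group `𝒪` for `A → C` and `B → C`, which is syzygy finite
    (O : AddSubgroup (K0 (BoundQuiverOp IC)))
    (hO : O = orbitSubgroup
      (NonUnitalRingHom.op (quotientMap (SquareQuiver.algInclA J K k) fun x => (hA x).1))
      (NonUnitalRingHom.op (quotientMap (SquareQuiver.algInclB J K k) fun x => (hB x).1)))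
    (hsyz : K0.SyzygyFinite O)
    (hfA : findim (BoundQuiverOp IA) < ⊤) (hfB : findim (BoundQuiverOp IB) < ⊤) :
    findim (BoundQuiverOp IC) < ⊤ ∧
      ∀ M : FGModuleCat.{u} (BoundQuiverOp IC), projectiveDimension M.obj < ⊤ →
        projectiveDimension M.obj ≤
          max (findim (BoundQuiverOp IA)) (findim (BoundQuiverOp IB)) + 2 +
            findimOn {N : FGModuleCat.{u} (BoundQuiverOp IC) | K0.mk N ∈ O} := by
  subst hO
  have : IsArtinianRing (BoundQuiverOp IA) := IsArtinianRing.of_finite k _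
  have : IsArtinianRing (BoundQuiverOp IB) := IsArtinianRing.of_finite k _
  have : IsArtinianRing (BoundQuiverOp IC) := IsArtinianRing.of_finite k _
  exact ((SquareQuiver.isMixedIdeal hmixed).isDiagonalPair hIC hA hB).findim_lt_top_and_le
    hsyz hfA hfB
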